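/- There is a universal constant $C$ such that for all integers $n\ge 2$ and $q\ge 1$ there is a randomized algorithm with the following properties. The algorithm interacts in rounds with an oracle for an unknown probability distribution $\mu$ on $[q]^n$: in each round it submits a finite batch of queries simultaneously, chosen depending on its random seed and on the answers of the earlier rounds. A query consists of an index $i\in[n]$, a set $S\subseteq[n]$ and a partial configuration $\sigma_S\in[q]^S$; its answer is the vector of conditional marginals $\big(\mathbb P_{X\sim\mu}[X_i=x\mid X_S=\sigma_S]\big)_{x\in[q]}$ if $\mathbb P_{X\sim\mu}[X_S=\sigma_S]>0$, and an arbitrary probability vector on $[q]$ otherwise. For every probability distribution $\mu$ on $[q]^n$ and every such oracle for $\mu$: 1. the output of the algorithm is distributed exactly according to $\mu$; 2. the total number of queries is at most $C\,n$ for every value of the seed; 3. the expected number of rounds is at most $$C\,n^{2/3}\cdot\min\{\log^{2/3} n\cdot\log q,\; q^{1/3}\log^{1/3} q\}.$$ -/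

import Mathlib

open MeasureTheory

/-- A conditional marginal query about a random vector `X` with values in `[q]^n`: it asks for the
conditional distribution of the coordinate `X_target`, given that `X_j = value j` for all `j` in the
set `pinned`. -/
structure Query (n q : ℕ) where
  target : Fin n
  pinned : Finset (Fin n)
  value : {j : Fin n // j ∈ pinned} → Fin q

/-- The event `X_S = σ_S` on which a query conditions. -/
def Query.event {n q : ℕ} (Q : Query n q) : Set (Fin n → Fin q) :=
  {X | ∀ j : {j : Fin n // j ∈ Q.pinned}, X j = Q.value j}

/-- An oracle answers every query with a probability vector on `[q]`
(the probabilities of all `x : Fin q` at once). -/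
abbrev Oracle (n q : ℕ) : Type := Query n q → stdSimplex ℝ (Fin q)

/-- `O` is a conditional marginal oracle for `μ`: whenever the conditioning event has positive
probability, the answer is the vector of the probabilities `ℙ[X_i = x | X_S = σ_S]`.
Where the event has probability zero the conditional probability is undefined, and nothing is
assumed about the answer. -/
def IsConditionalMarginalOracle {n q : ℕ} (μ : Measure (Fin n → Fin q)) (O : Oracle n q) : Prop :=
  ∀ Q : Query n q, μ Q.event ≠ 0 →
    ∀ x : Fin q, (O Q : Fin q → ℝ) x = (ProbabilityTheory.cond μ Q.event).real {X | X Q.target = x}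

/-- A deterministic strategy that interacts with an oracle in rounds. It either stops with an
output in `[q]^n`, or starts a round: it submits a finite batch of queries simultaneously, and
continues in a way that depends on all the answers of the batch. -/
inductive Strategy (n q : ℕ) : Type
  | halt (x : Fin n → Fin q) : Strategy n q
  | ask (batch : List (Query n q))
      (next : (Fin batch.length → stdSimplex ℝ (Fin q)) → Strategy n q) : Strategy n q

/-- The output of a strategy that interacts with the oracle `O`. -/
def Strategy.output {n q : ℕ} (O : Oracle n q) : Strategy n q → (Fin n → Fin q)
  | .halt x => x
  | .ask batch next => (next fun k => O (batch.get k)).output O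

/-- The number of rounds of the interaction of a strategy with the oracle `O`. -/
def Strategy.rounds {n q : ℕ} (O : Oracle n q) : Strategy n q → ℕ
  | .halt _ => 0
  | .ask batch next => 1 + (next fun k => O (batch.get k)).rounds O

/-- The total number of queries, over all rounds, of a strategy that interacts with `O`. -/
def Strategy.queries {n q : ℕ} (O : Oracle n q) : Strategy n q → ℕ
  | .halt _ => 0
  | .ask batch next => batch.length + (next fun k => O (batch.get k)).queries O

/-- A randomized algorithm that interacts with an oracle in rounds: it draws a random seed and then
follows a strategy that is determined by the seed. For every oracle, the output, the number of
rounds and the number of queries are random variables. -/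
structure RandomizedSampler (n q : ℕ) where
  Seed : Type
  [seedSpace : MeasurableSpace Seed]
  law : Measure Seed
  [isProbabilityMeasure_law : IsProbabilityMeasure law]
  strategy : Seed → Strategy n q
  measurable_output : ∀ O : Oracle n q, Measurable fun s => (strategy s).output O
  measurable_rounds : ∀ O : Oracle n q, Measurable fun s => (strategy s).rounds O
  measurable_queries : ∀ O : Oracle n q, Measurable fun s => (strategy s).queries O

attribute [instance] RandomizedSampler.seedSpace RandomizedSampler.isProbabilityMeasure_law

/-- The coordinates at the first `k` positions of the order `σ`. -/
def revealed {n : ℕ} (σ : Equiv.Perm (Fin n)) (k : ℕ) : Finset (Fin n) :=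
  Finset.univ.filter fun j => (σ.symm j : ℕ) < k

/-- The positions in the interval `[a, e)`. -/
def positions (n a e : ℕ) : Finset (Fin n) :=
  Finset.univ.filter fun i => a ≤ (i : ℕ) ∧ (i : ℕ) < e

/-- The query for the coordinate at position `i`, given the coordinates of `x` at the first `k`
positions. -/
def prefixQuery {n q : ℕ} (σ : Equiv.Perm (Fin n)) (i : Fin n) (k : ℕ) (x : Fin n → Fin q) :
    Query n q :=
  ⟨σ i, revealed σ k, fun j => x j⟩

/-- Two configurations agree at the first `k` positions of the order `σ`. -/
def AgreeBelow {n q : ℕ} (σ : Equiv.Perm (Fin n)) (k : ℕ) (x y : Fin n → Fin q) : Prop :=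
  ∀ j : Fin n, (j : ℕ) < k → x (σ j) = y (σ j)

theorem mem_revealed {n : ℕ} {σ : Equiv.Perm (Fin n)} {k : ℕ} {j : Fin n} :
    j ∈ revealed σ k ↔ (σ.symm j : ℕ) < k := by
  simp [revealed]

theorem mem_positions {n a e : ℕ} {i : Fin n} :
    i ∈ positions n a e ↔ a ≤ (i : ℕ) ∧ (i : ℕ) < e := by
  simp [positions]

theorem card_positions_le (n a e : ℕ) : (positions n a e).card ≤ e - a := by
  rw [← Nat.card_Ico, ← Finset.card_map Fin.valEmbedding]
  apply Finset.card_le_card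
  intro i hi
  obtain ⟨j, hj, rfl⟩ := Finset.mem_map.1 hi
  exact Finset.mem_Ico.2 (mem_positions.1 hj)

theorem AgreeBelow.prefixQuery_eq {n q : ℕ} {σ : Equiv.Perm (Fin n)} {k : ℕ}
    {x y : Fin n → Fin q} (h : AgreeBelow σ k x y) (i : Fin n) :
    prefixQuery σ i k x = prefixQuery σ i k y := by
  unfold prefixQuery
  congr 1
  funext j
  have := h (σ.symm j) (mem_revealed.1 j.2)
  simpa using this

theorem AgreeBelow.mono {n q : ℕ} {σ : Equiv.Perm (Fin n)} {k l : ℕ}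
    {x y : Fin n → Fin q} (h : AgreeBelow σ k x y) (hl : l ≤ k) : AgreeBelow σ l x y :=
  fun j hj => h j (hj.trans_le hl)

/-- The table `g` of answers is consistent with `x` at the first `k` positions: revealing the
coordinates one by one in the order `σ` leads to `x`. -/
def ConsistentBelow {n q : ℕ} (g : Query n q → Fin q) (σ : Equiv.Perm (Fin n)) (k : ℕ)
    (x : Fin n → Fin q) : Prop :=
  ∀ i : Fin n, (i : ℕ) < k → g (prefixQuery σ i i x) = x (σ i)

theorem ConsistentBelow.agreeBelow {n q : ℕ} {g : Query n q → Fin q} {σ : Equiv.Perm (Fin n)}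
    {k : ℕ} {x y : Fin n → Fin q} (hx : ConsistentBelow g σ k x) (hy : ConsistentBelow g σ k y) :
    AgreeBelow σ k x y := by
  suffices h : ∀ l ≤ k, AgreeBelow σ l x y from h k le_rfl
  intro l
  induction l with
  | zero => intro _ j hj; omega
  | succ l ih =>
    intro hl j hj
    have ha := (ih (by omega)).mono (Nat.lt_succ_iff.1 hj)
    rw [← hx j (by omega), ← hy j (by omega), ha.prefixQuery_eq]

theorem AgreeBelow.consistentBelow {n q : ℕ} {g : Query n q → Fin q} {σ : Equiv.Perm (Fin n)}
    {k : ℕ} {x y : Fin n → Fin q} (h : AgreeBelow σ k x y) (hy : ConsistentBelow g σ k y) :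
    ConsistentBelow g σ k x := by
  intro i hi
  rw [h i hi, (h.mono hi.le).prefixQuery_eq, hy i hi]

theorem exists_consistentBelow {n q : ℕ} [NeZero q] (g : Query n q → Fin q)
    (σ : Equiv.Perm (Fin n)) (k : ℕ) : ∃ x, ConsistentBelow g σ k x := by
  induction k with
  | zero => exact ⟨0, fun i hi => by omega⟩
  | succ k ih =>
    obtain ⟨x, hx⟩ := ih
    by_cases hk : k < n
    · have ha : AgreeBelow σ k
          (Function.update x (σ ⟨k, hk⟩) (g (prefixQuery σ ⟨k, hk⟩ k x))) x := by
        intro j hj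
        apply Function.update_of_ne
        intro h
        have := σ.injective h
        subst this
        simp at hj
      refine ⟨Function.update x (σ ⟨k, hk⟩) (g (prefixQuery σ ⟨k, hk⟩ k x)), fun i hi => ?_⟩
      rcases Nat.lt_succ_iff_lt_or_eq.1 hi with h | h
      · exact ha.consistentBelow hx i h
      · obtain rfl : i = ⟨k, hk⟩ := Fin.ext h
        simp only [Function.update_self]
        rw [ha.prefixQuery_eq]
    · exact ⟨x, fun i _ => hx i (by omega)⟩

theorem AgreeBelow.eq {n q : ℕ} {σ : Equiv.Perm (Fin n)} {k : ℕ} {x y : Fin n → Fin q}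
    (h : AgreeBelow σ k x y) (hk : n ≤ k) : x = y := by
  funext j
  simpa using h (σ.symm j) (by omega)

/-- The configuration that results from revealing the coordinates one by one in the order `σ`,
each according to the table `g`. -/
noncomputable def sequentialSample {n q : ℕ} [NeZero q] (g : Query n q → Fin q)
    (σ : Equiv.Perm (Fin n)) : Fin n → Fin q :=
  (exists_consistentBelow g σ n).choose

theorem sequentialSample_consistent {n q : ℕ} [NeZero q] (g : Query n q → Fin q)
    (σ : Equiv.Perm (Fin n)) (k : ℕ) : ConsistentBelow g σ k (sequentialSample g σ) :=
  fun i _ => (exists_consistentBelow g σ n).choose_spec i i.2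

theorem agreeBelow_sequentialSample_iff {n q : ℕ} [NeZero q] {g : Query n q → Fin q}
    {σ : Equiv.Perm (Fin n)} {k : ℕ} {x : Fin n → Fin q} :
    AgreeBelow σ k x (sequentialSample g σ) ↔ ConsistentBelow g σ k x :=
  ⟨fun h => h.consistentBelow (sequentialSample_consistent g σ k),
    fun h => h.agreeBelow (sequentialSample_consistent g σ k)⟩

namespace Strategy

variable {n q : ℕ} [NeZero q]

open Classical in
/-- Submit a batch of queries, convert each answer to a symbol by means of `c`, and continue
with the table of these symbols. -/
noncomputable def askAll (c : Query n q → stdSimplex ℝ (Fin q) → Fin q) (batch : List (Query n q))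
    (next : (Query n q → Fin q) → Strategy n q) : Strategy n q :=
  .ask batch fun ans => next fun Q =>
    if h : ∃ k, batch.get k = Q then c Q (ans h.choose) else 0

open Classical in
/-- The part of the table `fun Q => c Q (O Q)` that a batch of queries reveals. -/
noncomputable def revealedTable (c : Query n q → stdSimplex ℝ (Fin q) → Fin q) (O : Oracle n q)
    (batch : List (Query n q)) (Q : Query n q) : Fin q :=
  if Q ∈ batch then c Q (O Q) else 0

theorem revealedTable_of_mem {c : Query n q → stdSimplex ℝ (Fin q) → Fin q} {O : Oracle n q}
    {batch : List (Query n q)} {Q : Query n q} (h : Q ∈ batch) :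
    revealedTable c O batch Q = c Q (O Q) :=
  if_pos h

theorem askAll_table (c : Query n q → stdSimplex ℝ (Fin q) → Fin q) (O : Oracle n q)
    (batch : List (Query n q)) :
    (fun Q => open Classical in if h : ∃ k, batch.get k = Q then c Q (O (batch.get h.choose)) else 0)
      = revealedTable c O batch := by
  classical
  funext Q
  unfold revealedTable
  by_cases h : ∃ k, batch.get k = Q
  · rw [dif_pos h, if_pos (List.mem_iff_get.2 h), h.choose_spec]
  · rw [dif_neg h, if_neg (fun h' => h (List.mem_iff_get.1 h'))]

theorem output_askAll (c : Query n q → stdSimplex ℝ (Fin q) → Fin q) (O : Oracle n q)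
    (batch : List (Query n q)) (next : (Query n q → Fin q) → Strategy n q) :
    (askAll c batch next).output O = (next (revealedTable c O batch)).output O := by
  rw [← askAll_table]; rfl

theorem rounds_askAll (c : Query n q → stdSimplex ℝ (Fin q) → Fin q) (O : Oracle n q)
    (batch : List (Query n q)) (next : (Query n q → Fin q) → Strategy n q) :
    (askAll c batch next).rounds O = 1 + (next (revealedTable c O batch)).rounds O := by
  rw [← askAll_table]; rfl

theorem queries_askAll (c : Query n q → stdSimplex ℝ (Fin q) → Fin q) (O : Oracle n q)
    (batch : List (Query n q)) (next : (Query n q → Fin q) → Strategy n q) :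
    (askAll c batch next).queries O =
      batch.length + (next (revealedTable c O batch)).queries O := by
  rw [← askAll_table]; rfl

/-- The positions in `[a, e)` at which the table `t` does not confirm the guesses in `x`. -/
def mismatches (t : Query n q → Fin q) (σ : Equiv.Perm (Fin n)) (x : Fin n → Fin q) (a e : ℕ) :
    Finset (Fin n) :=
  (positions n a e).filter fun i => t (prefixQuery σ i i x) ≠ x (σ i)

/-- Verify the guesses in `x` at the positions in `[a, e)`, in batches of size `2 ^ L`. If a batch
is confirmed, the next one is twice as large. Otherwise the first wrong guess is corrected, and
the next batch starts behind it and is half as large. -/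
noncomputable def verify (c : Query n q → stdSimplex ℝ (Fin q) → Fin q) (σ : Equiv.Perm (Fin n))
    (e : ℕ) (cont : (Fin n → Fin q) → Strategy n q) :
    ℕ → ℕ → ℕ → (Fin n → Fin q) → Strategy n q
  | 0, _, _, x => cont x
  | fuel + 1, a, L, x =>
    if e ≤ a then cont x else
      askAll c ((positions n a (min (a + 2 ^ L) e)).toList.map fun i => prefixQuery σ i i x)
        fun t =>
          if h : (mismatches t σ x a (min (a + 2 ^ L) e)).Nonempty then
            let i := (mismatches t σ x a (min (a + 2 ^ L) e)).min' h
            verify c σ e cont fuel (i + 1) (L - 1)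
              (Function.update x (σ i) (t (prefixQuery σ i i x)))
          else verify c σ e cont fuel (min (a + 2 ^ L) e) (L + 1) x

/-- Sample `m` blocks of `θ` positions, beginning with block number `k`. All coordinates of a block
are guessed in one round, given the coordinates of the previous blocks, and then verified. -/
noncomputable def sampleBlocks (c : Query n q → stdSimplex ℝ (Fin q) → Fin q)
    (σ : Equiv.Perm (Fin n)) (θ : ℕ) : ℕ → ℕ → (Fin n → Fin q) → Strategy n q
  | 0, _, x => .halt x
  | m + 1, k, x =>
    askAll c ((positions n (θ * k) (θ * k + θ)).toList.map fun i => prefixQuery σ i (θ * k) x)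
      fun t => verify c σ (θ * k + θ) (sampleBlocks c σ θ m (k + 1)) θ (θ * k) (Nat.clog 2 θ)
        fun j => if σ.symm j ∈ positions n (θ * k) (θ * k + θ) then
          t (prefixQuery σ (σ.symm j) (θ * k) x) else x j

/-- The positions in `[a, e)` whose coordinate in `X` differs from the guess that is based on the
first `b` positions. -/
def wrongGuesses (g : Query n q → Fin q) (σ : Equiv.Perm (Fin n)) (X : Fin n → Fin q)
    (b a e : ℕ) : Finset (Fin n) :=
  (positions n a e).filter fun i => g (prefixQuery σ i b X) ≠ X (σ i)

theorem verify_spec (c : Query n q → stdSimplex ℝ (Fin q) → Fin q) (σ : Equiv.Perm (Fin n))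
    (O : Oracle n q) (cont : (Fin n → Fin q) → Strategy n q) {X : Fin n → Fin q}
    (hX : ConsistentBelow (fun Q => c Q (O Q)) σ n X) {b e M : ℕ} (he : e ≤ b + 2 ^ M)
    (fuel a L : ℕ) (x : Fin n → Fin q) (hfuel : e ≤ a + fuel) (hba : b ≤ a) (hL : L ≤ M)
    (hx : AgreeBelow σ a x X)
    (hguess : ∀ i ∈ positions n a e, 
      x (σ i) = c (prefixQuery σ i b X) (O (prefixQuery σ i b X))) :
    ∃ x', AgreeBelow σ e x' X ∧
      (verify c σ e cont fuel a L x).output O = (cont x').output O ∧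
      (verify c σ e cont fuel a L x).rounds O ≤ (cont x').rounds O + (if a < e then 1 else 0) +
        2 * (wrongGuesses (fun Q => c Q (O Q)) σ X b a e).card + (M - L) ∧
      (verify c σ e cont fuel a L x).queries O ≤ (cont x').queries O + 3 * (e - a) + 2 * 2 ^ L := by
  induction fuel generalizing a L x with
  | zero => exact ⟨x, hx.mono (by omega), rfl, by simp only [verify]; omega,
      by simp only [verify]; omega⟩
  | succ fuel ih =>
    by_cases hae : e ≤ a
    · exact ⟨x, hx.mono hae, by simp only [verify, if_pos hae],
        by simp only [verify, if_pos hae]; omega, by simp only [verify, if_pos hae]; omega⟩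
    set a' := min (a + 2 ^ L) e with ha'
    have hpow : 0 < 2 ^ L := by positivity
    set batch := (positions n a a').toList.map fun i => prefixQuery σ i i x with hbatch
    set t := revealedTable c O batch with ht
    have hlen : batch.length ≤ a' - a := by
      simpa [hbatch] using card_positions_le n a a'
    have htab : ∀ i ∈ positions n a a', 
        t (prefixQuery σ i i x) = c (prefixQuery σ i i x) (O (prefixQuery σ i i x)) := by
      intro i hi
      exact revealedTable_of_mem (List.mem_map.2 ⟨i, Finset.mem_toList.2 hi, rfl⟩)
    -- below the first wrong guess, the guesses agree with `X`
    have hagree : ∀ l ≤ a', (∀ i ∈ positions n a l, t (prefixQuery σ i i x) = x (σ i)) →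
        AgreeBelow σ l x X := by
      intro l hl hgood
      have : ConsistentBelow (fun Q => c Q (O Q)) σ l x := by
        intro i hi
        by_cases hia : (i : ℕ) < a
        · exact hx.consistentBelow (g := fun Q => c Q (O Q)) (fun i _ => hX i i.2) i hia
        · have hi' : i ∈ positions n a l := mem_positions.2 ⟨by omega, hi⟩
          rw [← hgood i hi', htab i (mem_positions.2 ⟨by omega, by omega⟩)]
      exact this.agreeBelow fun i _ => hX i i.2
    have hstep : verify c σ e cont (fuel + 1) a L x = askAll c batch fun t =>
        if h : (mismatches t σ x a a').Nonempty then
          verify c σ e cont fuel ((mismatches t σ x a a').min' h + 1) (L - 1)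
            (Function.update x (σ ((mismatches t σ x a a').min' h))
              (t (prefixQuery σ ((mismatches t σ x a a').min' h) ((mismatches t σ x a a').min' h) x)))
        else verify c σ e cont fuel a' (L + 1) x := by
      rw [verify, if_neg hae]
    by_cases hbad : (mismatches t σ x a a').Nonempty
    · have hmem := Finset.min'_mem _ hbad
      have hmin : ∀ j ∈ positions n a a', j < (mismatches t σ x a a').min' hbad →
          t (prefixQuery σ j j x) = x (σ j) := by
        intro j hj hlt
        by_contra hne
        exact absurd (Finset.min'_le _ j (Finset.mem_filter.2 ⟨hj, hne⟩)) (not_le.2 hlt)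
      rw [hstep, output_askAll, rounds_askAll, queries_askAll, ← ht, dif_pos hbad]
      generalize (mismatches t σ x a a').min' hbad = i at *
      obtain ⟨hipos, hine⟩ := Finset.mem_filter.1 hmem
      obtain ⟨hai, hia'⟩ := mem_positions.1 hipos
      have hie : (i : ℕ) < e := hia'.trans_le (min_le_right _ _)
      have hxi : AgreeBelow σ i x X := hagree i hia'.le fun j hj => by
        obtain ⟨h1, h2⟩ := mem_positions.1 hj
        exact hmin j (mem_positions.2 ⟨h1, h2.trans hia'⟩) h2
      have hti : t (prefixQuery σ i i x) = X (σ i) := by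
        rw [htab i hipos, hxi.prefixQuery_eq]
        exact hX i i.2
      have hwrong : i ∈ wrongGuesses (fun Q => c Q (O Q)) σ X b a e := by
        refine Finset.mem_filter.2 ⟨mem_positions.2 ⟨hai, hie⟩, ?_⟩
        beta_reduce
        rw [← hguess i (mem_positions.2 ⟨hai, hie⟩), ← hti]
        exact hine.symm
      have hcard : (wrongGuesses (fun Q => c Q (O Q)) σ X b (i + 1) e).card + 1 ≤
          (wrongGuesses (fun Q => c Q (O Q)) σ X b a e).card := by
        apply Finset.card_lt_card
        refine (Finset.ssubset_iff_of_subset ?_).2 ⟨i, hwrong, ?_⟩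
        · refine Finset.filter_subset_filter _ fun j hj => ?_
          rw [mem_positions] at hj ⊢
          omega
        · simp [wrongGuesses, mem_positions]
      obtain ⟨x', h1, h2, h3, h4⟩ := ih (i + 1) (L - 1)
        (Function.update x (σ i) (t (prefixQuery σ i i x))) (by omega) (by omega) (by omega)
        (fun j hj => by
          rcases eq_or_ne j i with rfl | hne
          · simpa using hti
          · rw [Function.update_of_ne (σ.injective.ne hne)]
            exact hxi j (by have := Fin.val_ne_of_ne hne; omega))
        (fun j hj => by
          rw [mem_positions] at hj
          have hne : j ≠ i := by rintro rfl; omega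
          rw [Function.update_of_ne (σ.injective.ne hne)]
          exact hguess j (mem_positions.2 ⟨by omega, hj.2⟩))
      refine ⟨x', h1, h2, ?_, ?_⟩
      · rw [if_pos (not_le.1 hae)]
        split_ifs at h3 <;> omega
      · have hb : batch.length ≤ 2 ^ L := by omega
        rcases L with _ | L
        · simp only [Nat.zero_sub, pow_zero] at *
          omega
        · simp only [Nat.add_sub_cancel, pow_succ] at *
          omega
    · have hstep : verify c σ e cont (fuel + 1) a L x = askAll c batch fun t =>
          if h : (mismatches t σ x a a').Nonempty then
            verify c σ e cont fuel ((mismatches t σ x a a').min' h + 1) (L - 1)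
              (Function.update x (σ ((mismatches t σ x a a').min' h))
                (t (prefixQuery σ ((mismatches t σ x a a').min' h) ((mismatches t σ x a a').min' h) x)))
          else verify c σ e cont fuel a' (L + 1) x := by
        rw [verify, if_neg hae]
      rw [hstep, output_askAll, rounds_askAll, queries_askAll, ← ht, dif_neg hbad]
      have hgood : AgreeBelow σ a' x X := hagree a' le_rfl fun i hi => by
        by_contra hne
        exact hbad ⟨i, Finset.mem_filter.2 ⟨hi, hne⟩⟩
      by_cases hfin : e ≤ a + 2 ^ L
      · have ha'e : a' = e := min_eq_right hfin
        have hdone : verify c σ e cont fuel a' (L + 1) x = cont x := by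
          cases fuel with
          | zero => rfl
          | succ f => rw [verify, if_pos ha'e.ge]
        rw [hdone]
        refine ⟨x, ha'e ▸ hgood, rfl, ?_, by omega⟩
        rw [if_pos (not_le.1 hae)]
        omega
      · have ha'L : a' = a + 2 ^ L := min_eq_left (by omega)
        have hLM : L < M := (Nat.pow_lt_pow_iff_right (a := 2) (by norm_num)).1 (by omega)
        obtain ⟨x', h1, h2, h3, h4⟩ := ih a' (L + 1) x (by omega) (by omega) (by omega) hgood
          (fun i hi => hguess i (by rw [mem_positions] at hi ⊢; omega))
        refine ⟨x', h1, h2, ?_, ?_⟩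
        · have hcard : (wrongGuesses (fun Q => c Q (O Q)) σ X b a' e).card ≤
              (wrongGuesses (fun Q => c Q (O Q)) σ X b a e).card := by
            refine Finset.card_le_card (Finset.filter_subset_filter _ fun j hj => ?_)
            rw [mem_positions] at hj ⊢
            omega
          rw [if_pos (not_le.1 hae)]
          split_ifs at h3 <;> omega
        · rw [pow_succ] at h4
          omega

/-- The positions from `a` on whose coordinate in `X` differs from the guess that is made at the
beginning of their block. -/
def blockErrors (g : Query n q → Fin q) (σ : Equiv.Perm (Fin n)) (X : Fin n → Fin q)
    (θ a : ℕ) : Finset (Fin n) :=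
  Finset.univ.filter fun i => a ≤ (i : ℕ) ∧ g (prefixQuery σ i (θ * (i / θ)) X) ≠ X (σ i)

theorem sampleBlocks_spec (c : Query n q → stdSimplex ℝ (Fin q) → Fin q) (σ : Equiv.Perm (Fin n))
    (O : Oracle n q) {X : Fin n → Fin q}
    (hX : ConsistentBelow (fun Q => c Q (O Q)) σ n X) {θ : ℕ} (hθ : 0 < θ) (m k : ℕ)
    (x : Fin n → Fin q) (hx : AgreeBelow σ (θ * k) x X) :
    AgreeBelow σ (θ * (k + m)) ((sampleBlocks c σ θ m k x).output O) X ∧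
      (sampleBlocks c σ θ m k x).rounds O ≤
        2 * m + 2 * (blockErrors (fun Q => c Q (O Q)) σ X θ (θ * k)).card ∧
      (sampleBlocks c σ θ m k x).queries O ≤ 8 * θ * m := by
  induction m generalizing k x with
  | zero => exact ⟨hx, Nat.zero_le _, Nat.zero_le _⟩
  | succ m ih =>
    rw [sampleBlocks, output_askAll, rounds_askAll, queries_askAll]
    set batch := (positions n (θ * k) (θ * k + θ)).toList.map
      fun i => prefixQuery σ i (θ * k) x with hbatch
    have hlen : batch.length ≤ θ := by
      simpa [hbatch] using card_positions_le n (θ * k) (θ * k + θ)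
    have hclog : θ ≤ 2 ^ Nat.clog 2 θ := Nat.le_pow_clog (by norm_num) θ
    have hclog' : 2 ^ Nat.clog 2 θ ≤ 2 * θ := by
      rcases Nat.lt_or_ge 1 θ with h | h
      · have := Nat.pow_pred_clog_lt_self (b := 2) (by norm_num) h
        have hpos : 0 < Nat.clog 2 θ := Nat.clog_pos (by norm_num) h
        obtain ⟨l, hl⟩ := Nat.exists_eq_succ_of_ne_zero hpos.ne'
        rw [hl] at this ⊢
        simp only [Nat.pred_succ, pow_succ] at *
        omega
      · obtain rfl : θ = 1 := by omega
        simp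
    obtain ⟨x', h1, h2, h3, h4⟩ := verify_spec c σ O (sampleBlocks c σ θ m (k + 1)) hX
      (b := θ * k) (e := θ * k + θ) (M := Nat.clog 2 θ) (by omega) θ (θ * k) (Nat.clog 2 θ)
      (fun j => if σ.symm j ∈ positions n (θ * k) (θ * k + θ) then
          revealedTable c O batch (prefixQuery σ (σ.symm j) (θ * k) x) else x j) le_rfl le_rfl le_rfl
      (fun i hi => by
        simp only [Equiv.symm_apply_apply]
        rw [if_neg (by rw [mem_positions]; omega)]
        exact hx i hi)
      (fun i hi => by
        simp only [Equiv.symm_apply_apply]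
        rw [if_pos hi,
          revealedTable_of_mem (List.mem_map.2 ⟨i, Finset.mem_toList.2 hi, rfl⟩),
          hx.prefixQuery_eq])
    obtain ⟨h5, h6, h7⟩ := ih (k + 1) x' (by rwa [mul_add, mul_one])
    have hcard : (wrongGuesses (fun Q => c Q (O Q)) σ X (θ * k) (θ * k) (θ * k + θ)).card +
        (blockErrors (fun Q => c Q (O Q)) σ X θ (θ * (k + 1))).card ≤
        (blockErrors (fun Q => c Q (O Q)) σ X θ (θ * k)).card := by
      rw [← Finset.card_union_of_disjoint]
      · refine Finset.card_le_card fun i hi => ?_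
        rcases Finset.mem_union.1 hi with hi | hi
        · simp only [wrongGuesses, Finset.mem_filter, mem_positions] at hi
          have : (i : ℕ) / θ = k :=
            Nat.div_eq_of_lt_le (by rw [mul_comm]; exact hi.1.1)
              (by rw [mul_comm, Nat.mul_add, mul_one]; exact hi.1.2)
          simp only [blockErrors, Finset.mem_filter, Finset.mem_univ, true_and, this]
          exact ⟨hi.1.1, hi.2⟩
        · simp only [blockErrors, Finset.mem_filter, Finset.mem_univ, true_and, mul_add] at hi ⊢
          exact ⟨by omega, hi.2⟩
      · refine Finset.disjoint_left.2 fun i hi hi' => ?_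
        simp only [wrongGuesses, Finset.mem_filter, mem_positions] at hi
        simp only [blockErrors, Finset.mem_filter, Finset.mem_univ, true_and, mul_add] at hi'
        omega
    refine ⟨?_, ?_, ?_⟩
    · rw [h2, show k + (m + 1) = k + 1 + m by ring]
      exact h5
    · rw [if_pos (by omega)] at h3
      omega
    · rw [show θ * k + θ - θ * k = θ by omega] at h4
      rw [mul_add]
      omega

end Strategy

/-- `x` wins the race in which the clock of `y` rings at time `t y / p y`. -/
def WinsRace {q : ℕ} (p t : Fin q → ℝ) (x : Fin q) : Prop :=
  0 < p x ∧ ∀ y, y ≠ x → 0 < t x ∧ p y * t x < p x * t y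

theorem WinsRace.unique {q : ℕ} {p t : Fin q → ℝ} {x y : Fin q}
    (hx : WinsRace p t x) (hy : WinsRace p t y) : x = y := by
  by_contra h
  exact lt_asymm (hx.2 y (Ne.symm h)).2 (hy.2 x h).2

open Classical in
/-- The winner of the race with speeds `p`. -/
noncomputable def raceWinner {q : ℕ} [NeZero q] (p t : Fin q → ℝ) : Fin q :=
  if h : ∃ x, WinsRace p t x then h.choose else 0

theorem WinsRace.raceWinner_eq {q : ℕ} [NeZero q] {p t : Fin q → ℝ} {x : Fin q}
    (h : WinsRace p t x) : raceWinner p t = x := by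
  have h' : ∃ x, WinsRace p t x := ⟨x, h⟩
  rw [raceWinner, dif_pos h']
  exact h'.choose_spec.unique h

theorem measurableSet_winsRace {q : ℕ} (p : Fin q → ℝ) (x : Fin q) :
    MeasurableSet {t | WinsRace p t x} := by
  unfold WinsRace
  measurability

theorem measurable_raceWinner {q : ℕ} [NeZero q] (p : Fin q → ℝ) : Measurable (raceWinner p) := by
  classical
  refine measurable_to_countable' fun x => ?_
  have : raceWinner p ⁻¹' {x} =
      {t | WinsRace p t x} ∪ ({t | x = 0} ∩ ⋂ y, {t | WinsRace p t y}ᶜ) := by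
    ext t
    simp only [Set.mem_preimage, Set.mem_singleton_iff, Set.mem_union, Set.mem_inter_iff,
      Set.mem_iInter, Set.mem_compl_iff, Set.mem_ofPred_eq]
    constructor
    · intro h
      by_cases hw : ∃ y, WinsRace p t y
      · obtain ⟨y, hy⟩ := hw
        left
        rwa [← h, hy.raceWinner_eq]
      · right
        rw [raceWinner, dif_neg hw] at h
        exact ⟨h.symm, not_exists.1 hw⟩
    · rintro (h | ⟨h, hw⟩)
      · exact h.raceWinner_eq
      · rw [raceWinner, dif_neg (not_exists.2 hw), h]
  rw [this]
  exact (measurableSet_winsRace p x).union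
    ((MeasurableSet.const _).inter (MeasurableSet.iInter fun y => (measurableSet_winsRace p y).compl))

/-- The law of independent exponential clocks. -/
noncomputable def clockLaw (q : ℕ) : Measure (Fin q → ℝ) :=
  Measure.pi fun _ => ProbabilityTheory.expMeasure 1

instance : IsProbabilityMeasure (ProbabilityTheory.expMeasure 1) :=
  ProbabilityTheory.isProbabilityMeasure_expMeasure one_pos

instance (q : ℕ) : IsProbabilityMeasure (clockLaw q) := by
  unfold clockLaw; infer_instance

theorem expMeasure_Ioi {s : ℝ} (hs : 0 ≤ s) :
    ProbabilityTheory.expMeasure 1 (Set.Ioi s) = ENNReal.ofReal (Real.exp (-s)) := by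
  have h := ProbabilityTheory.cdf_expMeasure_eq one_pos s
  rw [ProbabilityTheory.cdf_eq_real, if_pos hs, one_mul] at h
  have h2 := probReal_compl_eq_one_sub (μ := ProbabilityTheory.expMeasure 1)
    (measurableSet_Iic (a := s))
  rw [h, Set.compl_Iic, sub_sub_cancel] at h2
  rw [← h2, ofReal_measureReal]

theorem expMeasure_Iic_zero : ProbabilityTheory.expMeasure 1 (Set.Iic 0) = 0 := by
  have h := ProbabilityTheory.cdf_expMeasure_eq one_pos 0
  rw [ProbabilityTheory.cdf_eq_real, if_pos le_rfl] at h
  simpa [measureReal_def, ENNReal.toReal_eq_zero_iff] using h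

theorem lintegral_exp_neg_expMeasure {c : ℝ} (hc : 0 ≤ c) :
    ∫⁻ s, ENNReal.ofReal (Real.exp (-(c * s))) ∂(ProbabilityTheory.expMeasure 1) =
      ENNReal.ofReal (1 / (1 + c)) := by
  have h1 : (0 : ℝ) < 1 + c := by positivity
  have hd : ProbabilityTheory.expMeasure 1 =
      volume.withDensity (ProbabilityTheory.exponentialPDF 1) := rfl
  have hm : ∀ r, Measurable (ProbabilityTheory.exponentialPDF r) := fun r =>
    (ProbabilityTheory.measurable_exponentialPDFReal r).ennreal_ofReal
  rw [hd, lintegral_withDensity_eq_lintegral_mul _ (hm 1) (by fun_prop)]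
  calc _ = ∫⁻ s, ENNReal.ofReal (1 / (1 + c)) * ProbabilityTheory.exponentialPDF (1 + c) s := by
        congr 1
        funext s
        rw [Pi.mul_apply, ProbabilityTheory.exponentialPDF_eq, ProbabilityTheory.exponentialPDF_eq,
          ← ENNReal.ofReal_mul' (Real.exp_pos _).le, ← ENNReal.ofReal_mul (by positivity)]
        congr 1
        split_ifs
        · rw [one_mul, one_mul, ← Real.exp_add, ← mul_assoc, one_div_mul_cancel h1.ne', one_mul]
          congr 1
          ring
        · simp
    _ = _ := by
        rw [lintegral_const_mul _ (hm _), ProbabilityTheory.lintegral_exponentialPDF_eq_one h1,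
          mul_one]

/-- The probability that the clock of `x` rings first, if the other clocks are rescaled. -/
theorem clockLaw_first {q : ℕ} (x : Fin q) (c : Fin q → ℝ) (hc : ∀ y, 0 ≤ c y) :
    clockLaw q {t | 0 < t x ∧ ∀ y, y ≠ x → c y * t x < t y} =
      ENNReal.ofReal (1 / (1 + ∑ y ∈ Finset.univ.erase x, c y)) := by
  obtain _ | m := q
  · exact x.elim0
  have hmp := measurePreserving_piFinSuccAbove
    (fun _ : Fin (m + 1) => ProbabilityTheory.expMeasure 1) x
  set A : Set (ℝ × (Fin m → ℝ)) := {s | 0 < s.1 ∧ ∀ j, c (x.succAbove j) * s.1 < s.2 j} with hA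
  have hAm : MeasurableSet A := by
    rw [hA]
    measurability
  have hpre : {t : Fin (m + 1) → ℝ | 0 < t x ∧ ∀ y, y ≠ x → c y * t x < t y} =
      (MeasurableEquiv.piFinSuccAbove (fun _ => ℝ) x) ⁻¹' A := by
    ext t
    simp only [hA, Set.mem_preimage, Set.mem_ofPred_eq, MeasurableEquiv.piFinSuccAbove_apply,
      Fin.insertNthEquiv_symm_apply, Fin.removeNth]
    refine and_congr_right fun _ => ⟨fun h j => h _ (Fin.succAbove_ne x j), fun h y hy => ?_⟩
    obtain ⟨j, rfl⟩ := Fin.exists_succAbove_eq hy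
    exact h j
  have hsum : ∑ y ∈ Finset.univ.erase x, c y = ∑ j, c (x.succAbove j) := by
    rw [← add_right_inj (c x), Finset.add_sum_erase _ _ (Finset.mem_univ x),
      Fin.sum_univ_succAbove _ x]
  rw [clockLaw, hpre, hmp.measure_preimage hAm.nullMeasurableSet, Measure.prod_apply hAm, hsum,
    ← lintegral_exp_neg_expMeasure (Finset.sum_nonneg fun j _ => hc _)]
  apply lintegral_congr_ae
  have hpos : ∀ᵐ s ∂(ProbabilityTheory.expMeasure 1), 0 < s := by
    rw [ae_iff]
    simpa [Set.Iic] using expMeasure_Iic_zero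
  filter_upwards [hpos] with s hs
  have : Prod.mk s ⁻¹' A = Set.univ.pi fun j => Set.Ioi (c (x.succAbove j) * s) := by
    ext t
    simp [hA, hs]
  rw [this, Measure.pi_pi, Finset.sum_mul, ← Finset.sum_neg_distrib, Real.exp_sum,
    ENNReal.ofReal_prod_of_nonneg fun _ _ => (Real.exp_pos _).le]
  exact Finset.prod_congr rfl fun j _ => expMeasure_Ioi (mul_nonneg (hc _) hs.le)

/-- If `x` wins the race of speeds `m x` against `M y`, it wins all races in between. -/
theorem le_clockLaw_race {q : ℕ} (x : Fin q) {m : ℝ} (M : Fin q → ℝ) (hm : 0 < m)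
    (hM : ∀ y, 0 ≤ M y) (hmM : m ≤ M x) :
    ENNReal.ofReal (m / ∑ y, M y) ≤
      clockLaw q {t | 0 < t x ∧ ∀ y, y ≠ x → M y * t x < m * t y} := by
  have h := clockLaw_first x (fun y => M y / m) fun y => div_nonneg (hM y) hm.le
  have hset : {t : Fin q → ℝ | 0 < t x ∧ ∀ y, y ≠ x → M y / m * t x < t y} =
      {t | 0 < t x ∧ ∀ y, y ≠ x → M y * t x < m * t y} := by
    ext t
    refine and_congr_right fun _ => forall₂_congr fun y _ => ?_
    rw [div_mul_eq_mul_div, div_lt_iff₀ hm, mul_comm (t y)]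
  rw [← hset, h]
  apply ENNReal.ofReal_le_ofReal
  have hs : 0 ≤ ∑ y ∈ Finset.univ.erase x, M y := Finset.sum_nonneg fun y _ => hM y
  rw [← Finset.add_sum_erase _ _ (Finset.mem_univ x), ← Finset.sum_div,
    show 1 + (∑ y ∈ Finset.univ.erase x, M y) / m = (m + ∑ y ∈ Finset.univ.erase x, M y) / m by
      field_simp, one_div_div]
  gcongr

theorem clockLaw_le_of_sum {q : ℕ} {ι : Type*} [Fintype ι] {A : ι → Set (Fin q → ℝ)}
    (hA : ∀ i, MeasurableSet (A i)) (hdisj : Pairwise (Function.onFun Disjoint A)) :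
    ∑ i, (clockLaw q).real (A i) ≤ 1 := by
  rw [← measureReal_iUnion_fintype hdisj hA]
  exact measureReal_le_one

/-- The winner of the race with speeds `p` has the distribution `p`. -/
theorem clockLaw_raceWinner {q : ℕ} [NeZero q] (p : stdSimplex ℝ (Fin q)) (x : Fin q) :
    (clockLaw q).real {t | raceWinner p t = x} = p x := by
  have hp0 : ∀ y, 0 ≤ p y := p.2.1
  have hp1 : ∑ y, p y = 1 := p.2.2
  have hm : ∀ y, MeasurableSet {t | raceWinner p t = y} := fun y =>
    measurable_raceWinner _ (MeasurableSet.singleton y)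
  have hle : ∀ y, p y ≤ (clockLaw q).real {t | raceWinner p t = y} := by
    intro y
    rcases (hp0 y).eq_or_lt with h | h
    · rw [← h]; exact measureReal_nonneg
    have h1 := le_clockLaw_race y p h hp0 le_rfl
    rw [hp1, div_one] at h1
    rw [measureReal_def]
    refine (ENNReal.ofReal_le_iff_le_toReal (measure_ne_top _ _)).1 (h1.trans (measure_mono ?_))
    exact fun t ht => WinsRace.raceWinner_eq ⟨h, fun z hz => ⟨ht.1, ht.2 z hz⟩⟩
  have hsum : ∑ y, (clockLaw q).real {t | raceWinner p t = y} ≤ ∑ y, p y := by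
    rw [hp1]
    exact clockLaw_le_of_sum hm fun y z hyz => Set.disjoint_left.2
      fun t (hy : raceWinner p t = y) (hz : raceWinner p t = z) => hyz (hy.symm.trans hz)
  have heq := (Finset.sum_eq_sum_iff_of_le fun y _ => hle y).1
    (le_antisymm (Finset.sum_le_sum fun y _ => hle y) hsum)
  exact (heq x (Finset.mem_univ x)).symm

/-- The winners of two races that are run with the same clocks differ with probability at most
the `ℓ¹`-distance of the speeds. -/
theorem clockLaw_raceWinner_ne {q : ℕ} [NeZero q] (p r : stdSimplex ℝ (Fin q)) :
    (clockLaw q).real {t | raceWinner p t ≠ raceWinner r t} ≤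
      ∑ x, |p x - r x| := by
  set P := (p : Fin q → ℝ)
  set R := (r : Fin q → ℝ)
  have hP : ∀ y, 0 ≤ P y := p.2.1
  have hR : ∀ y, 0 ≤ R y := r.2.1
  have hPs : ∑ y, P y = 1 := p.2.2
  have hRs : ∑ y, R y = 1 := r.2.2
  have hM : ∀ y, 0 ≤ max (P y) (R y) := fun y => (hP y).trans (le_max_left _ _)
  set S := ∑ y, max (P y) (R y) with hS
  set T := ∑ y, |P y - R y| with hT
  have hmax : 2 * S = 2 + T := by
    have : ∀ y, 2 * max (P y) (R y) = P y + R y + |P y - R y| := fun y => by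
      rcases le_total (P y) (R y) with h | h
      · rw [max_eq_right h, abs_of_nonpos (sub_nonpos.2 h)]; ring
      · rw [max_eq_left h, abs_of_nonneg (sub_nonneg.2 h)]; ring
    rw [hS, Finset.mul_sum, Finset.sum_congr rfl fun y _ => this y, Finset.sum_add_distrib,
      Finset.sum_add_distrib, hPs, hRs, ← hT]
    ring
  have hmin : 2 * ∑ y, min (P y) (R y) = 2 - T := by
    have : ∀ y, 2 * min (P y) (R y) = P y + R y - |P y - R y| := fun y => by
      rcases le_total (P y) (R y) with h | h
      · rw [min_eq_left h, abs_of_nonpos (sub_nonpos.2 h)]; ring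
      · rw [min_eq_right h, abs_of_nonneg (sub_nonneg.2 h)]; ring
    rw [Finset.mul_sum, Finset.sum_congr rfl fun y _ => this y, Finset.sum_sub_distrib,
      Finset.sum_add_distrib, hPs, hRs, ← hT]
    ring
  have hT0 : 0 ≤ T := Finset.sum_nonneg fun _ _ => abs_nonneg _
  set A : Fin q → Set (Fin q → ℝ) := fun x => {t | raceWinner P t = x} ∩ {t | raceWinner R t = x}
  have hAm : ∀ x, MeasurableSet (A x) := fun x =>
    (measurable_raceWinner _ (MeasurableSet.singleton x)).inter
      (measurable_raceWinner _ (MeasurableSet.singleton x))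
  have hdisj : Pairwise (Function.onFun Disjoint A) := fun y z hyz =>
    Set.disjoint_left.2 fun t hy hz => hyz (hy.1.symm.trans hz.1)
  have hle : ∀ x, min (P x) (R x) / S ≤ (clockLaw q).real (A x) := by
    intro x
    rcases (le_min (hP x) (hR x)).eq_or_lt with h | h
    · rw [← h, zero_div]; exact measureReal_nonneg
    have h1 := le_clockLaw_race x (fun y => max (P y) (R y)) h hM
      ((min_le_left _ _).trans (le_max_left _ _))
    refine (ENNReal.ofReal_le_iff_le_toReal (measure_ne_top _ _)).1 (h1.trans (measure_mono ?_))
    have key : ∀ p' : Fin q → ℝ, (∀ y, p' y ≤ max (P y) (R y)) → min (P x) (R x) ≤ p' x →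
        ∀ t : Fin q → ℝ, (0 < t x ∧ ∀ y, y ≠ x → max (P y) (R y) * t x < min (P x) (R x) * t y) →
        raceWinner p' t = x := by
      intro p' h1 h2 t ht
      refine WinsRace.raceWinner_eq ⟨h.trans_le h2, fun y hy => ⟨ht.1, ?_⟩⟩
      have h3 := ht.2 y hy
      have ht0 : 0 < t y := by
        have : 0 < min (P x) (R x) * t y := lt_of_le_of_lt (mul_nonneg (hM y) ht.1.le) h3
        exact (mul_pos_iff_of_pos_left h).1 this
      calc p' y * t x ≤ max (P y) (R y) * t x := mul_le_mul_of_nonneg_right (h1 y) ht.1.le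
        _ < min (P x) (R x) * t y := h3
        _ ≤ p' x * t y := mul_le_mul_of_nonneg_right h2 ht0.le
    exact fun t ht => ⟨key P (fun y => le_max_left _ _) (min_le_left _ _) t ht,
      key R (fun y => le_max_right _ _) (min_le_right _ _) t ht⟩
  have hU : {t | raceWinner P t ≠ raceWinner R t} = (⋃ x, A x)ᶜ := by
    ext t
    simp only [Set.mem_ofPred_eq, Set.mem_compl_iff, Set.mem_iUnion, A, Set.mem_inter_iff, not_exists,
      not_and]
    exact ⟨fun h x h1 h2 => h (h1.trans h2.symm), fun h h' => h _ rfl h'.symm⟩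
  rw [hU, probReal_compl_eq_one_sub (MeasurableSet.iUnion hAm), measureReal_iUnion_fintype hdisj hAm]
  have h2 : (∑ y, min (P y) (R y)) / S ≤ ∑ x, (clockLaw q).real (A x) := by
    rw [Finset.sum_div]
    exact Finset.sum_le_sum fun x _ => hle x
  have hSpos : 0 < S := by linarith
  have h3 : 1 - T ≤ (∑ y, min (P y) (R y)) / S := by
    rw [le_div_iff₀ hSpos]
    nlinarith
  linarith

section Cylinder

variable {n q : ℕ} {w : (Fin n → Fin q) → ℝ}

/-- The total weight of the configurations that agree with `x` on `S`. -/
def cylinderWeight (w : (Fin n → Fin q) → ℝ) (S : Finset (Fin n)) (x : Fin n → Fin q) : ℝ :=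
  ∑ z with ∀ j ∈ S, z j = x j, w z

theorem cylinderWeight_nonneg (hw : ∀ x, 0 ≤ w x) (S : Finset (Fin n)) (x : Fin n → Fin q) :
    0 ≤ cylinderWeight w S x :=
  Finset.sum_nonneg fun z _ => hw z

theorem cylinderWeight_anti (hw : ∀ x, 0 ≤ w x) {S T : Finset (Fin n)} (h : S ⊆ T)
    (x : Fin n → Fin q) : cylinderWeight w T x ≤ cylinderWeight w S x := by
  refine Finset.sum_le_sum_of_subset_of_nonneg (fun z hz => ?_) fun z _ _ => hw z
  simp only [Finset.mem_filter, Finset.mem_univ, true_and] at hz ⊢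
  exact fun j hj => hz j (h hj)

theorem le_cylinderWeight (hw : ∀ x, 0 ≤ w x) (S : Finset (Fin n)) (x : Fin n → Fin q) :
    w x ≤ cylinderWeight w S x :=
  Finset.single_le_sum (f := w) (fun z _ => hw z) (by simp)

theorem cylinderWeight_empty (x : Fin n → Fin q) : cylinderWeight w ∅ x = ∑ z, w z := by
  simp [cylinderWeight]

theorem cylinderWeight_congr {S : Finset (Fin n)} {x y : Fin n → Fin q}
    (h : ∀ j ∈ S, x j = y j) : cylinderWeight w S x = cylinderWeight w S y := by
  unfold cylinderWeight
  congr 1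
  ext z
  simp only [Finset.mem_filter, Finset.mem_univ, true_and]
  exact forall₂_congr fun j hj => by rw [h j hj]

theorem sum_cylinderWeight_mul {S : Finset (Fin n)} {j : Fin n} (hj : j ∉ S) (x : Fin n → Fin q)
    (F : Fin q → ℝ) :
    ∑ y, cylinderWeight w (insert j S) (Function.update x j y) * F y =
      ∑ z with ∀ i ∈ S, z i = x i, w z * F (z j) := by
  rw [← Finset.sum_fiberwise (s := Finset.univ.filter fun z : Fin n → Fin q => ∀ i ∈ S, z i = x i)
    (g := fun z => z j)]
  refine Finset.sum_congr rfl fun y _ => ?_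
  rw [cylinderWeight, Finset.sum_mul, Finset.filter_filter]
  refine Finset.sum_congr ?_ fun z hz => ?_
  · ext z
    simp only [Finset.mem_filter, Finset.mem_univ, true_and, Finset.mem_insert, forall_eq_or_imp,
      Function.update_self]
    rw [and_comm]
    refine and_congr_left fun _ => forall₂_congr fun i hi => ?_
    rw [Function.update_of_ne (ne_of_mem_of_not_mem hi hj)]
  · rw [(Finset.mem_filter.1 hz).2.2]

theorem sum_cylinderWeight_update {S : Finset (Fin n)} {j : Fin n} (hj : j ∉ S)
    (x : Fin n → Fin q) :
    ∑ y, cylinderWeight w (insert j S) (Function.update x j y) = cylinderWeight w S x := by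
  simpa [cylinderWeight] using sum_cylinderWeight_mul (w := w) hj x fun _ => 1

/-- The conditional probability that coordinate `j` equals `y`, given that the coordinates in `S`
are those of `x`. -/
noncomputable def conditionalWeight (w : (Fin n → Fin q) → ℝ) (S : Finset (Fin n)) (j : Fin n)
    (x : Fin n → Fin q) (y : Fin q) : ℝ :=
  cylinderWeight w (insert j S) (Function.update x j y) / cylinderWeight w S x

theorem conditionalWeight_nonneg (hw : ∀ x, 0 ≤ w x) (S : Finset (Fin n)) (j : Fin n)
    (x : Fin n → Fin q) (y : Fin q) : 0 ≤ conditionalWeight w S j x y :=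
  div_nonneg (cylinderWeight_nonneg hw _ _) (cylinderWeight_nonneg hw _ _)

theorem conditionalWeight_congr {S : Finset (Fin n)} {j : Fin n} {x x' : Fin n → Fin q}
    (h : ∀ i ∈ S, x i = x' i) (y : Fin q) :
    conditionalWeight w S j x y = conditionalWeight w S j x' y := by
  unfold conditionalWeight
  rw [cylinderWeight_congr h, cylinderWeight_congr (x := Function.update x j y)
    (y := Function.update x' j y)]
  intro i hi
  rcases eq_or_ne i j with rfl | hne
  · simp
  · rw [Function.update_of_ne hne, Function.update_of_ne hne]
    exact h i ((Finset.mem_insert.1 hi).resolve_left hne)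

theorem conditionalWeight_self (S : Finset (Fin n)) (j : Fin n) (x : Fin n → Fin q) :
    conditionalWeight w S j x (x j) = cylinderWeight w (insert j S) x / cylinderWeight w S x := by
  rw [conditionalWeight, Function.update_eq_self]

theorem sum_conditionalWeight {S : Finset (Fin n)} {j : Fin n} (hj : j ∉ S) {x : Fin n → Fin q}
    (hx : cylinderWeight w S x ≠ 0) : ∑ y, conditionalWeight w S j x y = 1 := by
  unfold conditionalWeight
  rw [← Finset.sum_div, sum_cylinderWeight_update hj, div_self hx]

/-- The law of total expectation. -/
theorem sum_conditionalWeight_mul (hw : ∀ x, 0 ≤ w x) {T : Finset (Fin n)} {j : Fin n}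
    (hj : j ∉ T) (G : (Fin n → Fin q) → Fin q → ℝ)
    (hG : ∀ x x', (∀ i ∈ T, x i = x' i) → G x = G x') :
    ∑ x, w x * ∑ y, conditionalWeight w T j x y * G x y = ∑ x, w x * G x (x j) := by
  have h1 : ∀ x, w x * ∑ y, conditionalWeight w T j x y * G x y =
      ∑ z, if ∀ i ∈ T, z i = x i then w x * (w z * G z (z j) / cylinderWeight w T z) else 0 := by
    intro x
    have : ∀ y, conditionalWeight w T j x y * G x y =
        cylinderWeight w (insert j T) (Function.update x j y) * (G x y / cylinderWeight w T x) :=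
      fun y => by rw [conditionalWeight]; ring
    simp only [this]
    rw [sum_cylinderWeight_mul hj, Finset.mul_sum, Finset.sum_filter]
    refine Finset.sum_congr rfl fun z _ => ?_
    split_ifs with h
    · rw [cylinderWeight_congr h, hG z x h]
      ring
    · rfl
  simp only [h1]
  rw [Finset.sum_comm]
  refine Finset.sum_congr rfl fun z _ => ?_
  have h2 : ∀ x, (if ∀ i ∈ T, z i = x i then w x * (w z * G z (z j) / cylinderWeight w T z) else 0)
      = (if ∀ i ∈ T, x i = z i then w x else 0) * (w z * G z (z j) / cylinderWeight w T z) := by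
    intro x
    simp only [eq_comm (a := z _), ite_mul, zero_mul]
  simp only [h2]
  rw [← Finset.sum_mul, ← Finset.sum_filter, ← cylinderWeight]
  rcases eq_or_ne (cylinderWeight w T z) 0 with h | h
  · have : w z = 0 := le_antisymm (h ▸ le_cylinderWeight hw T z) (hw z)
    simp [this]
  · field_simp

/-- The entropy of the coordinates in `S`. -/
noncomputable def cylinderEntropy (w : (Fin n → Fin q) → ℝ) (S : Finset (Fin n)) : ℝ :=
  ∑ x, w x * -Real.log (cylinderWeight w S x)

theorem cylinderEntropy_empty (hw1 : ∑ x, w x = 1) : cylinderEntropy w ∅ = 0 := by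
  simp [cylinderEntropy, cylinderWeight_empty, hw1]

theorem cylinderEntropy_mono (hw : ∀ x, 0 ≤ w x) {S T : Finset (Fin n)} (h : S ⊆ T) :
    cylinderEntropy w S ≤ cylinderEntropy w T := by
  refine Finset.sum_le_sum fun x _ => ?_
  rcases (hw x).eq_or_lt with h0 | h0
  · simp [← h0]
  · have := h0.trans_le (le_cylinderWeight hw T x)
    exact mul_le_mul_of_nonneg_left
      (neg_le_neg (Real.log_le_log this (cylinderWeight_anti hw h x))) (hw x)

theorem cylinderEntropy_singleton_le (hw : ∀ x, 0 ≤ w x) (hw1 : ∑ x, w x = 1) (hq : 0 < q)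
    (j : Fin n) : cylinderEntropy w {j} ≤ Real.log q := by
  have hq' : (0 : ℝ) < q := Nat.cast_pos.2 hq
  have hpt : ∀ x, w x * -Real.log (cylinderWeight w {j} x) ≤
      w x * (Real.log q - 1) + (w x * (1 / conditionalWeight w ∅ j x (x j))) / q := by
    intro x
    rcases (hw x).eq_or_lt with h0 | h0
    · simp [← h0]
    have hc := h0.trans_le (le_cylinderWeight hw {j} x)
    have he : conditionalWeight w ∅ j x (x j) = cylinderWeight w {j} x := by
      rw [conditionalWeight_self, cylinderWeight_empty, hw1, div_one]
      rfl
    rw [he, mul_div_assoc, ← mul_add]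
    refine mul_le_mul_of_nonneg_left ?_ (hw x)
    have := Real.log_le_sub_one_of_pos (x := 1 / cylinderWeight w {j} x / q) (by positivity)
    rw [Real.log_div (by positivity) hq'.ne', Real.log_div one_ne_zero hc.ne', Real.log_one] at this
    linarith
  have htower := sum_conditionalWeight_mul hw (Finset.notMem_empty j)
    (fun x y => 1 / conditionalWeight w ∅ j x y)
    (fun x x' h => funext fun y => by rw [conditionalWeight_congr h])
  have hle : ∑ x, w x * ∑ y, conditionalWeight w ∅ j x y * (1 / conditionalWeight w ∅ j x y) ≤
      q := by
    calc _ ≤ ∑ x, w x * (q : ℝ) := by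
          refine Finset.sum_le_sum fun x _ => mul_le_mul_of_nonneg_left ?_ (hw x)
          calc _ ≤ ∑ _y : Fin q, (1 : ℝ) := Finset.sum_le_sum fun y _ => by
                rw [mul_one_div]; exact div_self_le_one _
            _ = q := by simp
      _ = q := by rw [← Finset.sum_mul, hw1, one_mul]
  refine (Finset.sum_le_sum fun x _ => hpt x).trans ?_
  rw [Finset.sum_add_distrib, ← Finset.sum_mul, hw1, one_mul, ← Finset.sum_div, ← htower]
  have := (div_le_one hq').2 hle
  linarith

/-- A form of Pinsker's inequality, for a likelihood ratio `ρ`. -/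
theorem sq_sum_mul_posPart_le {ι : Type*} (s : Finset ι) (w ρ : ι → ℝ) (hw : ∀ i ∈ s, 0 ≤ w i)
    (hw1 : ∑ i ∈ s, w i = 1) (hρ : ∀ i ∈ s, 0 < w i → 0 < ρ i) (hρ1 : ∑ i ∈ s, w i * ρ i ≤ 1) :
    (∑ i ∈ s, w i * max (1 - ρ i) 0) ^ 2 ≤ 4 * ∑ i ∈ s, w i * -Real.log (ρ i) := by
  have h1 : ∑ i ∈ s, w i * max (1 - ρ i) 0 ≤ ∑ i ∈ s, w i * (2 * |1 - √(ρ i)|) := by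
    refine Finset.sum_le_sum fun i hi => ?_
    rcases (hw i hi).eq_or_lt with h0 | h0
    · simp [← h0]
    refine mul_le_mul_of_nonneg_left (max_le ?_ (by positivity)) h0.le
    have hs := Real.sqrt_nonneg (ρ i)
    have hsq := Real.sq_sqrt (hρ i hi h0).le
    rcases le_total (√(ρ i)) 1 with h | h
    · rw [abs_of_nonneg (by linarith)]; nlinarith
    · have : 0 ≤ |1 - √(ρ i)| := abs_nonneg _
      nlinarith
  have h0 : 0 ≤ ∑ i ∈ s, w i * max (1 - ρ i) 0 :=
    Finset.sum_nonneg fun i hi => mul_nonneg (hw i hi) (le_max_right _ _)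
  have h2 : (∑ i ∈ s, w i * (2 * |1 - √(ρ i)|)) ^ 2 ≤
      (∑ i ∈ s, w i) * ∑ i ∈ s, w i * (2 * |1 - √(ρ i)|) ^ 2 := by
    have := Finset.sum_sq_le_sum_mul_sum_of_sq_le_mul s (r := fun i => w i * (2 * |1 - √(ρ i)|))
      (f := w) (g := fun i => w i * (2 * |1 - √(ρ i)|) ^ 2) hw
      (fun i hi => mul_nonneg (hw i hi) (sq_nonneg _))
      (fun i _ => le_of_eq (by ring))
    exact this
  have h3 : ∑ i ∈ s, w i * (2 * |1 - √(ρ i)|) ^ 2 ≤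
      ∑ i ∈ s, (4 * (w i * ρ i) - 4 * w i + 4 * (w i * -Real.log (ρ i))) := by
    refine Finset.sum_le_sum fun i hi => ?_
    rcases (hw i hi).eq_or_lt with h0 | h0
    · simp [← h0]
    have hp := hρ i hi h0
    have hsq := Real.sq_sqrt hp.le
    have hl := Real.log_le_sub_one_of_pos (Real.sqrt_pos.2 hp)
    rw [Real.log_sqrt hp.le] at hl
    rw [mul_pow, sq_abs]
    nlinarith
  rw [Finset.sum_add_distrib, Finset.sum_sub_distrib, ← Finset.mul_sum, ← Finset.mul_sum,
    ← Finset.mul_sum, hw1] at h3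
  rw [hw1, one_mul] at h2
  have := pow_le_pow_left₀ h0 h1 2
  linarith

/-- The expected `ℓ¹`-distance of two conditional distributions of the coordinate `j` is controlled
by the decrease of its conditional entropy. -/
theorem sq_sum_abs_conditionalWeight_sub_le (hw : ∀ x, 0 ≤ w x) (hw1 : ∑ x, w x = 1)
    {S T : Finset (Fin n)} (hST : S ⊆ T) {j : Fin n} (hj : j ∉ T) :
    (∑ x, w x * ∑ y, |conditionalWeight w S j x y - conditionalWeight w T j x y|) ^ 2 ≤
      16 * ((cylinderEntropy w (insert j S) - cylinderEntropy w S) -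
        (cylinderEntropy w (insert j T) - cylinderEntropy w T)) := by
  have hjS : j ∉ S := fun h => hj (hST h)
  set ρ : (Fin n → Fin q) → Fin q → ℝ :=
    fun x y => conditionalWeight w S j x y / conditionalWeight w T j x y with hρdef
  have hρ : ∀ x x', (∀ i ∈ T, x i = x' i) → ρ x = ρ x' := fun x x' h => funext fun y => by
    simp only [hρdef]
    rw [conditionalWeight_congr h, conditionalWeight_congr (S := S) fun i hi => h i (hST hi)]
  have hzero : ∀ x y, 0 < w x → conditionalWeight w S j x y = 0 →
      conditionalWeight w T j x y = 0 := by
    intro x y hx h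
    unfold conditionalWeight at h ⊢
    rcases div_eq_zero_iff.1 h with h | h
    · rw [le_antisymm ((cylinderWeight_anti hw (Finset.insert_subset_insert j hST) _).trans h.le)
        (cylinderWeight_nonneg hw _ _), zero_div]
    · exact absurd h (hx.trans_le (le_cylinderWeight hw S x)).ne'
  have hdist : ∀ x, w x * ∑ y, |conditionalWeight w S j x y - conditionalWeight w T j x y| =
      2 * (w x * ∑ y, conditionalWeight w T j x y * max (1 - ρ x y) 0) := by
    intro x
    rcases (hw x).eq_or_lt with h0 | h0
    · simp [← h0]
    have hS := sum_conditionalWeight hjS (h0.trans_le (le_cylinderWeight hw S x)).ne'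
    have hT := sum_conditionalWeight hj (h0.trans_le (le_cylinderWeight hw T x)).ne'
    have hpt : ∀ y, |conditionalWeight w S j x y - conditionalWeight w T j x y| =
        2 * (conditionalWeight w T j x y * max (1 - ρ x y) 0) +
          (conditionalWeight w S j x y - conditionalWeight w T j x y) := by
      intro y
      have hSn := conditionalWeight_nonneg hw S j x y
      rcases (conditionalWeight_nonneg hw T j x y).eq_or_lt with h | h
      · rw [← h, sub_zero, abs_of_nonneg hSn]; ring
      · rw [mul_max_of_nonneg _ _ h.le, mul_zero, mul_sub, mul_one, hρdef,
          mul_div_cancel₀ _ h.ne']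
        rcases le_total (conditionalWeight w S j x y) (conditionalWeight w T j x y) with h' | h'
        · rw [abs_of_nonpos (by linarith), max_eq_left (by linarith)]; ring
        · rw [abs_of_nonneg (by linarith), max_eq_right (by linarith)]; ring
    rw [Finset.sum_congr rfl fun y _ => hpt y, Finset.sum_add_distrib, Finset.sum_sub_distrib, hS,
      hT, ← Finset.mul_sum]
    ring
  rw [Finset.sum_congr rfl fun x _ => hdist x, ← Finset.mul_sum,
    sum_conditionalWeight_mul hw hj (fun x y => max (1 - ρ x y) 0)
      (fun x x' h => by simp only [hρ x x' h])]
  have hpos : ∀ x, 0 < w x → ∀ U : Finset (Fin n), 0 < cylinderWeight w U x := fun x hx U =>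
    hx.trans_le (le_cylinderWeight hw U x)
  have hmean : ∑ x, w x * ρ x (x j) ≤ 1 := by
    rw [← sum_conditionalWeight_mul hw hj ρ hρ, ← hw1]
    refine Finset.sum_le_sum fun x _ => ?_
    rcases (hw x).eq_or_lt with h0 | h0
    · simp [← h0]
    refine (mul_le_mul_of_nonneg_left ?_ (hw x)).trans_eq (mul_one _)
    rw [← sum_conditionalWeight hjS (hpos x h0 S).ne']
    refine Finset.sum_le_sum fun y _ => ?_
    rw [hρdef]
    rcases (conditionalWeight_nonneg hw T j x y).eq_or_lt with h | h
    · rw [← h, zero_mul]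
      exact conditionalWeight_nonneg hw S j x y
    · rw [mul_div_cancel₀ _ h.ne']
  have hlog : ∑ x, w x * -Real.log (ρ x (x j)) =
      (cylinderEntropy w (insert j S) - cylinderEntropy w S) -
        (cylinderEntropy w (insert j T) - cylinderEntropy w T) := by
    unfold cylinderEntropy
    simp only [← Finset.sum_sub_distrib]
    refine Finset.sum_congr rfl fun x _ => ?_
    rcases (hw x).eq_or_lt with h0 | h0
    · simp [← h0]
    have h := hpos x h0
    simp only [hρdef, conditionalWeight_self]
    rw [Real.log_div (div_pos (h _) (h _)).ne' (div_pos (h _) (h _)).ne',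
      Real.log_div (h _).ne' (h _).ne', Real.log_div (h _).ne' (h _).ne']
    ring
  have := sq_sum_mul_posPart_le Finset.univ w (fun x => ρ x (x j)) (fun x _ => hw x) hw1
    (fun x _ h0 => by
      simp only [hρdef, conditionalWeight_self]
      exact div_pos (div_pos (hpos x h0 _) (hpos x h0 _)) (div_pos (hpos x h0 _) (hpos x h0 _)))
    hmean
  rw [hlog] at this
  rw [mul_pow]
  linarith

end Cylinder

theorem real_cylinder {n q : ℕ} (μ : Measure (Fin n → Fin q)) [IsProbabilityMeasure μ]
    (S : Finset (Fin n)) (x : Fin n → Fin q) :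
    μ.real {X | ∀ j ∈ S, X j = x j} = cylinderWeight (fun z => μ.real {z}) S x := by
  rw [cylinderWeight, sum_measureReal_singleton]
  simp

theorem IsConditionalMarginalOracle.apply_eq {n q : ℕ} {μ : Measure (Fin n → Fin q)}
    [IsProbabilityMeasure μ] {O : Oracle n q} (hO : IsConditionalMarginalOracle μ O)
    {S : Finset (Fin n)} {i : Fin n} (hi : i ∉ S) {x : Fin n → Fin q}
    (hx : cylinderWeight (fun z => μ.real {z}) S x ≠ 0) (y : Fin q) :
    O ⟨i, S, fun j => x j⟩ y = conditionalWeight (fun z => μ.real {z}) S i x y := by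
  have hev : Query.event ⟨i, S, fun j => x j⟩ = {X | ∀ j ∈ S, X j = x j} := by
    ext X
    simp [Query.event]
  have hne : μ (Query.event ⟨i, S, fun j => x j⟩) ≠ 0 := by
    intro h
    rw [hev] at h
    rw [← real_cylinder, measureReal_def, h] at hx
    exact hx rfl
  refine (hO _ hne y).trans ?_
  rw [hev, measureReal_def, ProbabilityTheory.cond_apply (Set.toFinite _).measurableSet,
    ENNReal.toReal_mul, ENNReal.toReal_inv, ← measureReal_def, ← measureReal_def, real_cylinder,
    conditionalWeight, ← real_cylinder μ (insert i S), inv_mul_eq_div]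
  congr 2
  ext X
  simp only [Set.mem_inter_iff, Set.mem_ofPred_eq, Finset.mem_insert, forall_eq_or_imp,
    Function.update_self]
  rw [and_comm]
  refine and_congr_right fun _ => forall₂_congr fun j hj => ?_
  rw [Function.update_of_ne (ne_of_mem_of_not_mem hj hi)]

theorem self_notMem_revealed {n : ℕ} (σ : Equiv.Perm (Fin n)) (i : Fin n) {k : ℕ} (hk : k ≤ i) :
    σ i ∉ revealed σ k := by
  rw [mem_revealed, Equiv.symm_apply_apply]
  omega

theorem insert_revealed {n : ℕ} (σ : Equiv.Perm (Fin n)) (i : Fin n) :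
    insert (σ i) (revealed σ i) = revealed σ (i + 1) := by
  ext j
  rw [Finset.mem_insert, mem_revealed, mem_revealed, Nat.lt_succ_iff_lt_or_eq, or_comm,
    ← Equiv.symm_apply_eq, Fin.ext_iff]

theorem agreeBelow_iff_revealed {n q : ℕ} {σ : Equiv.Perm (Fin n)} {k : ℕ} {x y : Fin n → Fin q} :
    AgreeBelow σ k x y ↔ ∀ j ∈ revealed σ k, x j = y j := by
  constructor
  · intro h j hj
    simpa using h (σ.symm j) (mem_revealed.1 hj)
  · intro h j hj
    exact h (σ j) (by simpa [mem_revealed] using hj)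

/-- The law of independent exponential clocks, `q` for every coordinate. -/
noncomputable def noiseLaw (n q : ℕ) : Measure (Fin n → Fin q → ℝ) :=
  Measure.pi fun _ => clockLaw q

instance (n q : ℕ) : IsProbabilityMeasure (noiseLaw n q) := by
  unfold noiseLaw; infer_instance

/-- The symbols that are sampled from the answers of an oracle by means of the clocks `u`. -/
noncomputable def sampledTable {n q : ℕ} [NeZero q] (O : Oracle n q) (u : Fin n → Fin q → ℝ)
    (Q : Query n q) : Fin q :=
  raceWinner (O Q) (u Q.target)

instance (n q : ℕ) : Finite (Query n q) :=
  Finite.of_injective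
    (fun Q => (⟨Q.target, Q.pinned, Q.value⟩ :
      Fin n × (S : Finset (Fin n)) × ({j : Fin n // j ∈ S} → Fin q)))
    fun Q R h => by
      cases Q; cases R
      simpa using h

theorem measurable_sampledTable {n q : ℕ} [NeZero q] (O : Oracle n q) :
    Measurable (sampledTable (n := n) O) :=
  measurable_pi_lambda _ fun Q => (measurable_raceWinner _).comp (measurable_pi_apply Q.target)

theorem measurableSet_sampledTable {n q : ℕ} [NeZero q] (O : Oracle n q)
    (P : (Query n q → Fin q) → Prop) : MeasurableSet {u | P (sampledTable O u)} :=
  measurable_sampledTable O (Set.toFinite {g | P g}).measurableSet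

theorem noiseLaw_consistentBelow_and {n q : ℕ} [NeZero q] (O : Oracle n q)
    (σ : Equiv.Perm (Fin n)) (i : Fin n) (x : Fin n → Fin q) (D : Set (Fin q → ℝ)) :
    (noiseLaw n q).real {u | ConsistentBelow (sampledTable O u) σ i x ∧ u (σ i) ∈ D} =
      (noiseLaw n q).real {u | ConsistentBelow (sampledTable O u) σ i x} *
        (clockLaw q).real D := by
  set A : Set (Fin q → ℝ) → Fin n → Set (Fin q → ℝ) := fun D j =>
    if (σ.symm j : ℕ) < i then {t | raceWinner (O (prefixQuery σ (σ.symm j) (σ.symm j) x)) t = x j}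
    else if j = σ i then D else Set.univ with hA
  have hcons : ∀ D, {u | ConsistentBelow (sampledTable O u) σ i x ∧ u (σ i) ∈ D} =
      Set.univ.pi (A D) := by
    intro D
    ext u
    simp only [Set.mem_ofPred_eq, Set.mem_pi, Set.mem_univ, forall_true_left]
    constructor
    · rintro ⟨h, hD⟩ j
      simp only [hA]
      split_ifs with h1 h2
      · have := h (σ.symm j) h1
        simpa [sampledTable, prefixQuery] using this
      · exact h2 ▸ hD
      · trivial
    · intro h
      refine ⟨fun j hj => ?_, ?_⟩
      · have := h (σ j)
        simp only [hA, Equiv.symm_apply_apply, if_pos hj] at this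
        exact this
      · have := h (σ i)
        simpa [hA] using this
  have hprod : ∀ D, (noiseLaw n q).real
      {u | ConsistentBelow (sampledTable O u) σ i x ∧ u (σ i) ∈ D} =
        (clockLaw q).real D *
          ∏ j ∈ Finset.univ.erase (σ i), (clockLaw q).real (A Set.univ j) := by
    intro D
    rw [hcons, noiseLaw, measureReal_def, Measure.pi_pi, ENNReal.toReal_prod,
      ← Finset.mul_prod_erase _ _ (Finset.mem_univ (σ i))]
    congr 1
    · simp [hA, measureReal_def]
    · refine Finset.prod_congr rfl fun j hj => ?_
      simp only [hA, measureReal_def, if_neg (Finset.ne_of_mem_erase hj)]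
  have huniv := hprod Set.univ
  simp only [Set.mem_univ, and_true, probReal_univ, one_mul] at huniv
  rw [hprod, huniv, mul_comm]

section Law

variable {n q : ℕ} [NeZero q] {μ : Measure (Fin n → Fin q)} [IsProbabilityMeasure μ]
  {O : Oracle n q}

theorem noiseLaw_consistentBelow (hO : IsConditionalMarginalOracle μ O) (σ : Equiv.Perm (Fin n))
    (k : ℕ) (hk : k ≤ n) (x : Fin n → Fin q) :
    (noiseLaw n q).real {u | ConsistentBelow (sampledTable O u) σ k x} =
      cylinderWeight (fun z => μ.real {z}) (revealed σ k) x := by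
  have hw : ∀ z : Fin n → Fin q, 0 ≤ μ.real {z} := fun z => measureReal_nonneg
  induction k with
  | zero =>
    have h1 : {u | ConsistentBelow (sampledTable O u) σ 0 x} = Set.univ := by
      ext u
      simp [ConsistentBelow]
    have h2 : revealed σ 0 = ∅ := by simp [revealed]
    rw [h1, h2, ← real_cylinder]
    simp
  | succ k ih =>
    set i : Fin n := ⟨k, hk⟩
    have hset : {u | ConsistentBelow (sampledTable O u) σ (k + 1) x} =
        {u | ConsistentBelow (sampledTable O u) σ i x ∧
          u (σ i) ∈ {t | raceWinner (O (prefixQuery σ i i x)) t = x (σ i)}} := by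
      ext u
      simp only [Set.mem_ofPred_eq]
      constructor
      · exact fun h => ⟨fun j hj => h j (Nat.lt_succ_of_lt hj), h i (Nat.lt_succ_self k)⟩
      · rintro ⟨h1, h2⟩ j hj
        rcases Nat.lt_succ_iff_lt_or_eq.1 hj with h | h
        · exact h1 j h
        · obtain rfl : j = i := Fin.ext h
          exact h2
    rw [hset, noiseLaw_consistentBelow_and, clockLaw_raceWinner, ih (Nat.le_of_succ_le hk),
      show k + 1 = (i : ℕ) + 1 from rfl, ← insert_revealed]
    change cylinderWeight _ (revealed σ i) x * _ = _
    by_cases h0 : cylinderWeight (fun z => μ.real {z}) (revealed σ i) x = 0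
    · rw [h0, zero_mul]
      exact le_antisymm (cylinderWeight_nonneg hw _ _)
        ((cylinderWeight_anti hw (Finset.subset_insert _ _) x).trans h0.le)
    · rw [prefixQuery, hO.apply_eq (self_notMem_revealed σ i le_rfl) h0, conditionalWeight_self,
        mul_div_cancel₀ _ h0]

theorem noiseLaw_sequentialSample (hO : IsConditionalMarginalOracle μ O) (σ : Equiv.Perm (Fin n))
    (x : Fin n → Fin q) :
    noiseLaw n q {u | sequentialSample (sampledTable O u) σ = x} = μ {x} := by
  have hset : {u | sequentialSample (sampledTable O u) σ = x} =
      {u | ConsistentBelow (sampledTable O u) σ n x} := by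
    ext u
    simp only [Set.mem_ofPred_eq]
    rw [← agreeBelow_sequentialSample_iff]
    exact ⟨fun h j _ => by rw [h], fun h => (h.eq le_rfl).symm⟩
  rw [hset, ← ENNReal.toReal_eq_toReal_iff' (measure_ne_top _ _) (measure_ne_top _ _)]
  change (noiseLaw n q).real _ = μ.real _
  rw [noiseLaw_consistentBelow hO σ n le_rfl, ← real_cylinder]
  congr 1
  ext X
  simp [revealed, funext_iff]

/-- The expected `ℓ¹`-distance of the conditional distributions of the coordinate at position `i`,
given the first `b` and the first `i` positions. -/
noncomputable def guessDistance (w : (Fin n → Fin q) → ℝ) (σ : Equiv.Perm (Fin n)) (b : ℕ)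
    (i : Fin n) : ℝ :=
  ∑ x, w x * ∑ y, |conditionalWeight w (revealed σ b) (σ i) x y -
    conditionalWeight w (revealed σ i) (σ i) x y|

theorem noiseLaw_guess_ne_le (hO : IsConditionalMarginalOracle μ O) (σ : Equiv.Perm (Fin n))
    (i : Fin n) {b : ℕ} (hb : b ≤ i) :
    (noiseLaw n q).real {u | sampledTable O u
      (prefixQuery σ i b (sequentialSample (sampledTable O u) σ)) ≠
        sequentialSample (sampledTable O u) σ (σ i)} ≤
      guessDistance (fun z => μ.real {z}) σ b i := by
  classical
  have hw : ∀ z : Fin n → Fin q, 0 ≤ μ.real {z} := fun z => measureReal_nonneg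
  set w : (Fin n → Fin q) → ℝ := fun z => μ.real {z} with hwdef
  set ρ : (Fin n → Fin q) → (Fin n → Fin q) := fun z j => if j ∈ revealed σ i then z j else 0
    with hρdef
  have hρ : ∀ z, AgreeBelow σ i (ρ z) z := fun z => agreeBelow_iff_revealed.2 fun j hj => by
    simp only [hρdef, if_pos hj]
  have hidem : ∀ z, ρ (ρ z) = ρ z := fun z => by
    funext j
    simp only [hρdef]
    split_ifs <;> rfl
  set D : (Fin n → Fin q) → Set (Fin q → ℝ) := fun z =>
    {t | raceWinner (O (prefixQuery σ i b z)) t ≠ raceWinner (O (prefixQuery σ i i z)) t}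
  set δ : (Fin n → Fin q) → ℝ := fun z =>
    ∑ y, |O (prefixQuery σ i b z) y - O (prefixQuery σ i i z) y| with hδdef
  have hδ : ∀ z, δ (ρ z) = δ z := fun z => by
    simp only [hδdef]
    rw [((hρ z).mono hb).prefixQuery_eq, (hρ z).prefixQuery_eq]
  have hsub : {u | sampledTable O u (prefixQuery σ i b (sequentialSample (sampledTable O u) σ)) ≠
      sequentialSample (sampledTable O u) σ (σ i)} ⊆
      ⋃ z ∈ Finset.univ.filter fun z => ρ z = z,
        {u | ConsistentBelow (sampledTable O u) σ i z ∧ u (σ i) ∈ D z} := by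
    intro u hu
    simp only [Set.mem_iUnion]
    set X := sequentialSample (sampledTable O u) σ with hX
    refine ⟨ρ X, by simpa using hidem X, agreeBelow_sequentialSample_iff.1 (hρ X), ?_⟩
    have hself := sequentialSample_consistent (sampledTable O u) σ n i i.2
    rw [← hX] at hself
    rw [Set.mem_ofPred_eq, ← hX, ← hself] at hu
    change raceWinner _ _ ≠ raceWinner _ _
    rw [((hρ X).mono hb).prefixQuery_eq, (hρ X).prefixQuery_eq]
    exact hu
  calc _ ≤ ∑ z with ρ z = z, (noiseLaw n q).real
        {u | ConsistentBelow (sampledTable O u) σ i z ∧ u (σ i) ∈ D z} :=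
        (measureReal_mono hsub (measure_ne_top _ _)).trans (measureReal_biUnion_finset_le _ _)
    _ ≤ ∑ z with ρ z = z, cylinderWeight w (revealed σ i) z * δ z := by
        refine Finset.sum_le_sum fun z _ => ?_
        rw [noiseLaw_consistentBelow_and, noiseLaw_consistentBelow hO σ i i.2.le]
        exact mul_le_mul_of_nonneg_left (clockLaw_raceWinner_ne _ _)
          (cylinderWeight_nonneg hw _ _)
    _ = ∑ z with ρ z = z, ∑ x with ρ x = z, w x * δ x := by
        refine Finset.sum_congr rfl fun z hz => ?_
        have hz' : ρ z = z := (Finset.mem_filter.1 hz).2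
        rw [cylinderWeight, Finset.sum_mul]
        refine Finset.sum_congr ?_ fun x hx => ?_
        · ext x
          simp only [Finset.mem_filter, Finset.mem_univ, true_and]
          constructor
          · intro h
            rw [← hz']
            funext j
            simp only [hρdef]
            split_ifs with hj
            · exact h j hj
            · rfl
          · rintro rfl j hj
            simp only [hρdef, if_pos hj]
        · rw [← hδ x, (Finset.mem_filter.1 hx).2]
    _ = ∑ x, w x * δ x := by
        refine Finset.sum_fiberwise_of_maps_to (fun x _ => ?_) _
        simpa using hidem x
    _ = _ := by
        refine Finset.sum_congr rfl fun x _ => ?_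
        rcases (hw x).eq_or_lt with h0 | h0
        · simp only [hwdef, ← h0, zero_mul]
        · have hpos : ∀ U, cylinderWeight w U x ≠ 0 := fun U =>
            (h0.trans_le (le_cylinderWeight hw U x)).ne'
          simp only [hδdef, prefixQuery]
          congr 1
          refine Finset.sum_congr rfl fun y _ => ?_
          rw [hO.apply_eq (self_notMem_revealed σ i hb) (hpos _),
            hO.apply_eq (self_notMem_revealed σ i le_rfl) (hpos _)]

end Law

namespace Strategy

variable {n q : ℕ} [NeZero q]

/-- Two strategies have the same numbers of rounds and queries when they interact with `O`. -/
def SameCost (O : Oracle n q) (s t : Strategy n q) : Prop :=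
  s.rounds O = t.rounds O ∧ s.queries O = t.queries O

theorem sameCost_askAll {O : Oracle n q} {c c' : Query n q → stdSimplex ℝ (Fin q) → Fin q}
    (hc : ∀ Q, c Q (O Q) = c' Q (O Q)) (batch : List (Query n q))
    {next next' : (Query n q → Fin q) → Strategy n q} (h : ∀ t, SameCost O (next t) (next' t)) :
    SameCost O (askAll c batch next) (askAll c' batch next') := by
  have : revealedTable c O batch = revealedTable c' O batch := by
    funext Q
    simp only [revealedTable, hc]
  refine ⟨?_, ?_⟩
  · rw [rounds_askAll, rounds_askAll, this, (h _).1]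
  · rw [queries_askAll, queries_askAll, this, (h _).2]

theorem sameCost_verify {O : Oracle n q} {c c' : Query n q → stdSimplex ℝ (Fin q) → Fin q}
    (hc : ∀ Q, c Q (O Q) = c' Q (O Q)) (σ : Equiv.Perm (Fin n)) (e : ℕ)
    {cont cont' : (Fin n → Fin q) → Strategy n q} (h : ∀ x, SameCost O (cont x) (cont' x))
    (fuel a L : ℕ) (x : Fin n → Fin q) :
    SameCost O (verify c σ e cont fuel a L x) (verify c' σ e cont' fuel a L x) := by
  induction fuel generalizing a L x with
  | zero => exact h x
  | succ fuel ih =>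
    rw [verify, verify]
    split_ifs
    · exact h x
    · refine sameCost_askAll hc _ fun t => ?_
      split_ifs
      · exact ih _ _ _
      · exact ih _ _ _

theorem sameCost_sampleBlocks {O : Oracle n q}
    {c c' : Query n q → stdSimplex ℝ (Fin q) → Fin q} (hc : ∀ Q, c Q (O Q) = c' Q (O Q))
    (σ : Equiv.Perm (Fin n)) (θ m k : ℕ) (x : Fin n → Fin q) :
    SameCost O (sampleBlocks c σ θ m k x) (sampleBlocks c' σ θ m k x) := by
  induction m generalizing k x with
  | zero => exact ⟨rfl, rfl⟩
  | succ m ih =>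
    exact sameCost_askAll hc _ fun t => sameCost_verify hc σ _ (fun x => ih _ x) _ _ _ _

/-- The strategy that samples all coordinates in blocks of length `θ`, in the order `σ`, by means
of the clocks `u`. -/
noncomputable def blockSampler (θ : ℕ) (σ : Equiv.Perm (Fin n)) (u : Fin n → Fin q → ℝ) :
    Strategy n q :=
  sampleBlocks (fun Q p => raceWinner p (u Q.target)) σ θ (n / θ + 1) 0 0

theorem blockSampler_spec {θ : ℕ} (hθ : 0 < θ) (σ : Equiv.Perm (Fin n)) (u : Fin n → Fin q → ℝ)
    (O : Oracle n q) :
    (blockSampler θ σ u).output O = sequentialSample (sampledTable O u) σ ∧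
      (blockSampler θ σ u).rounds O ≤ 2 * (n / θ + 1) + 2 * (blockErrors (sampledTable O u) σ
        (sequentialSample (sampledTable O u) σ) θ 0).card ∧
      (blockSampler θ σ u).queries O ≤ 8 * θ * (n / θ + 1) := by
  obtain ⟨h1, h2, h3⟩ := sampleBlocks_spec (fun Q p => raceWinner p (u Q.target)) σ O
    (sequentialSample_consistent (sampledTable O u) σ n) hθ (n / θ + 1) 0 0
    (fun j hj => by omega)
  refine ⟨h1.eq ?_, h2, h3⟩
  have := Nat.lt_mul_div_succ n hθ
  rw [zero_add]
  exact this.le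

end Strategy

instance (n : ℕ) : MeasurableSpace (Equiv.Perm (Fin n)) := ⊤

instance (n : ℕ) : MeasurableSingletonClass (Equiv.Perm (Fin n)) := ⟨fun _ => trivial⟩

/-- The law of a uniformly random order of the coordinates. -/
noncomputable def orderLaw (n : ℕ) : Measure (Equiv.Perm (Fin n)) :=
  (Fintype.card (Equiv.Perm (Fin n)) : ENNReal)⁻¹ • Measure.count

theorem lintegral_orderLaw {n : ℕ} (f : Equiv.Perm (Fin n) → ENNReal) :
    ∫⁻ σ, f σ ∂(orderLaw n) = (Fintype.card (Equiv.Perm (Fin n)) : ENNReal)⁻¹ * ∑ σ, f σ := by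
  rw [orderLaw, lintegral_smul_measure, lintegral_count, tsum_fintype, smul_eq_mul]

instance (n : ℕ) : IsProbabilityMeasure (orderLaw n) := ⟨by
  rw [← lintegral_one, lintegral_orderLaw, Finset.sum_const, Finset.card_univ, nsmul_eq_mul,
    mul_one]
  exact ENNReal.inv_mul_cancel (by simp [Fintype.card_ne_zero]) (ENNReal.natCast_ne_top _)⟩

theorem measurable_of_sampledTable {n q : ℕ} [NeZero q] {β : Type*} [MeasurableSpace β]
    (O : Oracle n q) (F : Equiv.Perm (Fin n) → (Query n q → Fin q) → β) :
    Measurable fun s : Equiv.Perm (Fin n) × (Fin n → Fin q → ℝ) => F s.1 (sampledTable O s.2) := by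
  have h : Measurable fun p : Equiv.Perm (Fin n) × (Query n q → Fin q) => F p.1 p.2 :=
    Measurable.of_discrete
  exact h.comp (measurable_fst.prodMk ((measurable_sampledTable O).comp measurable_snd))

/-- The sampler in blocks of length `θ`, in a random order of the coordinates. -/
noncomputable def randomBlockSampler (n q : ℕ) [NeZero q] (θ : ℕ) (hθ : 0 < θ) :
    RandomizedSampler n q where
  Seed := Equiv.Perm (Fin n) × (Fin n → Fin q → ℝ)
  law := (orderLaw n).prod (noiseLaw n q)
  strategy s := Strategy.blockSampler θ s.1 s.2
  measurable_output O := by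
    simp only [(Strategy.blockSampler_spec hθ _ _ O).1]
    exact measurable_of_sampledTable O fun σ g => sequentialSample g σ
  measurable_rounds O := by
    have h := fun s : Equiv.Perm (Fin n) × (Fin n → Fin q → ℝ) =>
      (Strategy.sameCost_sampleBlocks (O := O) (c := fun Q p => raceWinner p (s.2 Q.target))
        (c' := fun Q _ => sampledTable O s.2 Q) (fun Q => rfl) s.1 θ (n / θ + 1) 0 0).1
    simp only [Strategy.blockSampler, h]
    exact measurable_of_sampledTable O fun σ g =>
      (Strategy.sampleBlocks (fun Q _ => g Q) σ θ (n / θ + 1) 0 0).rounds O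
  measurable_queries O := by
    have h := fun s : Equiv.Perm (Fin n) × (Fin n → Fin q → ℝ) =>
      (Strategy.sameCost_sampleBlocks (O := O) (c := fun Q p => raceWinner p (s.2 Q.target))
        (c' := fun Q _ => sampledTable O s.2 Q) (fun Q => rfl) s.1 θ (n / θ + 1) 0 0).2
    simp only [Strategy.blockSampler, h]
    exact measurable_of_sampledTable O fun σ g =>
      (Strategy.sampleBlocks (fun Q _ => g Q) σ θ (n / θ + 1) 0 0).queries O

theorem map_output_randomBlockSampler {n q : ℕ} [NeZero q] {θ : ℕ} (hθ : 0 < θ)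
    {μ : Measure (Fin n → Fin q)} [IsProbabilityMeasure μ] {O : Oracle n q}
    (hO : IsConditionalMarginalOracle μ O) :
    (randomBlockSampler n q θ hθ).law.map
      (fun s => ((randomBlockSampler n q θ hθ).strategy s).output O) = μ := by
  refine Measure.ext_of_singleton fun x => ?_
  rw [Measure.map_apply ((randomBlockSampler n q θ hθ).measurable_output O)
    (MeasurableSet.singleton x)]
  have hpre : (fun s => ((randomBlockSampler n q θ hθ).strategy s).output O) ⁻¹' {x} =
      {s : Equiv.Perm (Fin n) × (Fin n → Fin q → ℝ) |
        sequentialSample (sampledTable O s.2) s.1 = x} := by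
    ext s
    exact iff_of_eq (congrArg (· = x) (Strategy.blockSampler_spec hθ s.1 s.2 O).1)
  have hm : MeasurableSet {s : Equiv.Perm (Fin n) × (Fin n → Fin q → ℝ) |
        sequentialSample (sampledTable O s.2) s.1 = x} :=
    measurable_of_sampledTable O (fun σ g => sequentialSample g σ) (MeasurableSet.singleton x)
  rw [hpre]
  refine (Measure.prod_apply hm).trans ?_
  have : ∀ σ, noiseLaw n q (Prod.mk σ ⁻¹' {s : Equiv.Perm (Fin n) × (Fin n → Fin q → ℝ) |
        sequentialSample (sampledTable O s.2) s.1 = x}) = μ {x} :=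
    fun σ => noiseLaw_sequentialSample hO σ x
  exact (lintegral_congr this).trans (by simp)

theorem lintegral_rounds_randomBlockSampler_le {n q : ℕ} [NeZero q] {θ : ℕ} (hθ : 0 < θ)
    {μ : Measure (Fin n → Fin q)} [IsProbabilityMeasure μ] {O : Oracle n q}
    (hO : IsConditionalMarginalOracle μ O) :
    ∫⁻ s, (((randomBlockSampler n q θ hθ).strategy s).rounds O : ENNReal)
        ∂(randomBlockSampler n q θ hθ).law ≤
      ENNReal.ofReal (2 * ((n / θ : ℕ) + 1) + 2 * ((Fintype.card (Equiv.Perm (Fin n)) : ℝ)⁻¹ *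
        ∑ σ, ∑ i : Fin n, guessDistance (fun z => μ.real {z}) σ (θ * (i / θ)) i)) := by
  set δ : Equiv.Perm (Fin n) → Fin n → ℝ :=
    fun σ i => guessDistance (fun z => μ.real {z}) σ (θ * (i / θ)) i with hδ
  have hδ0 : ∀ σ i, 0 ≤ δ σ i := fun σ i => Finset.sum_nonneg fun x _ =>
    mul_nonneg measureReal_nonneg (Finset.sum_nonneg fun y _ => abs_nonneg _)
  have hmeas : Measurable fun s : Equiv.Perm (Fin n) × (Fin n → Fin q → ℝ) =>
      (((randomBlockSampler n q θ hθ).strategy s).rounds O : ENNReal) :=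
    (Measurable.of_discrete (f := fun k : ℕ => (k : ENNReal))).comp
      ((randomBlockSampler n q θ hθ).measurable_rounds O)
  refine (lintegral_prod _ hmeas.aemeasurable).trans_le ?_
  set K : ℝ := 2 * ((n / θ : ℕ) + 1) with hK
  have hK0 : 0 ≤ K := by positivity
  have hinner : ∀ σ : Equiv.Perm (Fin n), ∫⁻ u,
      (((randomBlockSampler n q θ hθ).strategy (σ, u)).rounds O : ENNReal) ∂(noiseLaw n q) ≤
        ENNReal.ofReal (K + 2 * ∑ i, δ σ i) := by
    intro σ
    set E : Fin n → Set (Fin n → Fin q → ℝ) := fun i => {u | sampledTable O u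
      (prefixQuery σ i (θ * (i / θ)) (sequentialSample (sampledTable O u) σ)) ≠
        sequentialSample (sampledTable O u) σ (σ i)}
    have hE : ∀ i, MeasurableSet (E i) := fun i =>
      measurableSet_sampledTable O fun g => g (prefixQuery σ i (θ * (i / θ)) (sequentialSample g σ)) ≠
        sequentialSample g σ (σ i)
    calc _ ≤ ∫⁻ u, (ENNReal.ofReal K + 2 * ∑ i, (E i).indicator 1 u) ∂(noiseLaw n q) := by
          refine lintegral_mono fun u => ?_
          have h := (Strategy.blockSampler_spec hθ σ u O).2.1
          have hcard : ∑ i, (E i).indicator (1 : (Fin n → Fin q → ℝ) → ENNReal) u = ((Strategy.blockErrors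
              (sampledTable O u) σ (sequentialSample (sampledTable O u) σ) θ 0).card : ENNReal) := by
            classical
            rw [Strategy.blockErrors, Finset.card_filter]
            push_cast
            refine Finset.sum_congr rfl fun i _ => ?_
            simp [Set.indicator_apply, E]
          rw [hcard, hK, show (2 * ((n / θ : ℕ) + 1) : ℝ) = ((2 * (n / θ + 1) : ℕ) : ℝ) by push_cast; ring,
            ENNReal.ofReal_natCast]
          have h' : ((Strategy.blockSampler θ σ u).rounds O : ENNReal) ≤ _ := Nat.cast_le.2 h
          push_cast at h' ⊢
          exact h'
      _ = ENNReal.ofReal K + 2 * ∑ i, noiseLaw n q (E i) := by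
          rw [lintegral_add_left measurable_const, lintegral_const, measure_univ, mul_one,
            lintegral_const_mul _ (Finset.measurable_sum _ fun i _ =>
              measurable_one.indicator (hE i)),
            lintegral_finsetSum _ fun i _ => measurable_one.indicator (hE i)]
          simp only [lintegral_indicator_one (hE _)]
      _ ≤ ENNReal.ofReal K + 2 * ∑ i, ENNReal.ofReal (δ σ i) := by
          gcongr with i
          rw [← ofReal_measureReal]
          exact ENNReal.ofReal_le_ofReal (noiseLaw_guess_ne_le hO σ i (Nat.mul_div_le _ _))
      _ = _ := by
          have hs : 0 ≤ ∑ i, δ σ i := Finset.sum_nonneg fun i _ => hδ0 σ i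
          rw [ENNReal.ofReal_add hK0 (by positivity),
            ENNReal.ofReal_mul (q := ∑ i, δ σ i) zero_le_two,
            ENNReal.ofReal_sum_of_nonneg fun i _ => hδ0 σ i, ENNReal.ofReal_ofNat]
  refine (lintegral_mono hinner).trans ?_
  have hs : ∀ σ, 0 ≤ K + 2 * ∑ i, δ σ i := fun σ =>
    add_nonneg hK0 (mul_nonneg zero_le_two (Finset.sum_nonneg fun i _ => hδ0 σ i))
  have hN : (0 : ℝ) < Fintype.card (Equiv.Perm (Fin n)) := Nat.cast_pos.2 Fintype.card_pos
  rw [lintegral_orderLaw, ← ENNReal.ofReal_sum_of_nonneg fun σ _ => hs σ,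
    ← ENNReal.ofReal_natCast, ← ENNReal.ofReal_inv_of_pos hN, ← ENNReal.ofReal_mul (by positivity)]
  apply ENNReal.ofReal_le_ofReal
  rw [Finset.sum_add_distrib, Finset.sum_const, Finset.card_univ, nsmul_eq_mul, ← Finset.mul_sum,
    mul_add, inv_mul_cancel_left₀ hN.ne']
  apply le_of_eq
  ring

section Average

variable {n q : ℕ} {w : (Fin n → Fin q) → ℝ}

theorem sum_cylinderEntropy_insert (w : (Fin n → Fin q) → ℝ) (i : Fin n) {b : ℕ} (hb : b ≤ i) :
    ∑ σ : Equiv.Perm (Fin n), cylinderEntropy w (insert (σ i) (revealed σ b)) =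
      ∑ σ : Equiv.Perm (Fin n), cylinderEntropy w (revealed σ (b + 1)) := by
  set b' : Fin n := ⟨b, by omega⟩ with hb'
  rw [← Equiv.sum_comp (Equiv.mulRight (Equiv.swap b' i))
    fun σ => cylinderEntropy w (revealed σ (b + 1))]
  refine Finset.sum_congr rfl fun σ _ => ?_
  congr 1
  have h := insert_revealed (σ * Equiv.swap b' i) b'
  rw [Equiv.coe_mulRight]
  refine Eq.trans ?_ h
  congr 1
  · simp
  · ext j
    rw [mem_revealed, mem_revealed]
    have : (σ * Equiv.swap b' i).symm j = Equiv.swap b' i (σ.symm j) := by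
      rw [Equiv.symm_apply_eq]
      simp
    rw [this]
    generalize σ.symm j = l
    rw [Equiv.swap_apply_def]
    split_ifs with h1 h2
    · subst h1
      simp [hb']
      omega
    · subst h2
      simp [hb']
      omega
    · rfl

/-- The sum over all orders of the conditional entropy of the coordinate at position `k`, given the
first `k` positions. -/
noncomputable def entropyIncrement (w : (Fin n → Fin q) → ℝ) (k : ℕ) : ℝ :=
  ∑ σ : Equiv.Perm (Fin n),
    (cylinderEntropy w (revealed σ (k + 1)) - cylinderEntropy w (revealed σ k))

theorem revealed_mono (σ : Equiv.Perm (Fin n)) {k l : ℕ} (h : k ≤ l) :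
    revealed σ k ⊆ revealed σ l := fun j hj => by
  rw [mem_revealed] at hj ⊢
  omega

theorem entropyIncrement_nonneg (hw : ∀ x, 0 ≤ w x) (k : ℕ) : 0 ≤ entropyIncrement w k :=
  Finset.sum_nonneg fun σ _ =>
    sub_nonneg.2 (cylinderEntropy_mono hw (revealed_mono σ (Nat.le_succ k)))

theorem sum_sq_guessDistance_le (hw : ∀ x, 0 ≤ w x) (hw1 : ∑ x, w x = 1) (i : Fin n) {b : ℕ}
    (hb : b ≤ i) :
    ∑ σ, guessDistance w σ b i ^ 2 ≤ 16 * (entropyIncrement w b - entropyIncrement w i) := by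
  calc _ ≤ ∑ σ, 16 * ((cylinderEntropy w (insert (σ i) (revealed σ b)) -
          cylinderEntropy w (revealed σ b)) - (cylinderEntropy w (insert (σ i) (revealed σ i)) -
          cylinderEntropy w (revealed σ i))) :=
        Finset.sum_le_sum fun σ _ => sq_sum_abs_conditionalWeight_sub_le hw hw1
          (revealed_mono σ hb) (self_notMem_revealed σ i le_rfl)
    _ = _ := by
        rw [← Finset.mul_sum, Finset.sum_sub_distrib, Finset.sum_sub_distrib,
          Finset.sum_sub_distrib, sum_cylinderEntropy_insert w i hb,
          sum_cylinderEntropy_insert w i le_rfl, entropyIncrement, entropyIncrement,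
          Finset.sum_sub_distrib, Finset.sum_sub_distrib]

theorem entropyIncrement_anti (hw : ∀ x, 0 ≤ w x) (hw1 : ∑ x, w x = 1) {b i : ℕ} (hb : b ≤ i)
    (hi : i < n) : entropyIncrement w i ≤ entropyIncrement w b := by
  have h := sum_sq_guessDistance_le hw hw1 ⟨i, hi⟩ (b := b) hb
  have h0 : 0 ≤ ∑ σ, guessDistance w σ b ⟨i, hi⟩ ^ 2 := Finset.sum_nonneg fun _ _ => sq_nonneg _
  change _ ≤ 16 * (_ - entropyIncrement w i) at h
  linarith

theorem entropyIncrement_zero_le (hw : ∀ x, 0 ≤ w x) (hw1 : ∑ x, w x = 1) (hq : 0 < q)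
    (hn : 0 < n) : entropyIncrement w 0 ≤ Fintype.card (Equiv.Perm (Fin n)) * Real.log q := by
  rw [entropyIncrement, ← nsmul_eq_mul, ← Finset.card_univ]
  refine Finset.sum_le_card_nsmul _ _ _ fun σ _ => ?_
  have h0 : revealed σ 0 = ∅ := by simp [revealed]
  have h1 := insert_revealed σ ⟨0, hn⟩
  simp only [h0, insert_empty_eq] at h1
  rw [← h1, h0, cylinderEntropy_empty hw1, sub_zero]
  exact cylinderEntropy_singleton_le hw hw1 hq _

/-- Rounding the arguments of a decreasing sequence down to multiples of `θ` increases its sum by at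
most `θ` times the first term. -/
theorem sum_mul_div_le {D : ℕ → ℝ} {n θ : ℕ} (hθ : 0 < θ) (hD : ∀ i, 0 ≤ D i)
    (hanti : ∀ b i, b ≤ i → i < n → D i ≤ D b) :
    ∑ i ∈ Finset.range n, D (θ * (i / θ)) ≤ θ * D 0 + ∑ i ∈ Finset.range n, D i := by
  have hsmall : ∀ m ≤ n, ∑ i ∈ Finset.range m, D (θ * (i / θ)) ≤ m * D 0 := by
    intro m hm
    have := Finset.sum_le_card_nsmul (Finset.range m) (fun i => D (θ * (i / θ))) (D 0)
      fun i hi => hanti _ _ (Nat.zero_le _)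
        ((Nat.mul_div_le i θ).trans_lt ((Finset.mem_range.1 hi).trans_le hm))
    simpa using this
  rcases le_total n θ with h | h
  · have h1 := hsmall n le_rfl
    have h2 : (n : ℝ) * D 0 ≤ θ * D 0 :=
      mul_le_mul_of_nonneg_right (Nat.cast_le.2 h) (hD 0)
    linarith [Finset.sum_nonneg fun i (_ : i ∈ Finset.range n) => hD i]
  · obtain ⟨m, rfl⟩ := Nat.exists_eq_add_of_le h
    rw [Finset.sum_range_add]
    refine add_le_add (hsmall θ h) ?_
    calc _ ≤ ∑ i ∈ Finset.range m, D i := by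
          refine Finset.sum_le_sum fun i hi => ?_
          have hi := Finset.mem_range.1 hi
          have h1 := Nat.lt_mul_div_succ (θ + i) hθ
          rw [mul_add, mul_one] at h1
          exact hanti _ _ (by omega) ((Nat.mul_div_le _ _).trans_lt (by omega))
      _ ≤ _ := Finset.sum_le_sum_of_subset_of_nonneg (Finset.range_mono (Nat.le_add_left _ _))
          fun i _ _ => hD i

/-- The expected total error of guessing in blocks of length `θ`, in a random order. -/
theorem average_guessDistance_le (hw : ∀ x, 0 ≤ w x) (hw1 : ∑ x, w x = 1) (hq : 0 < q)
    (hn : 0 < n) {θ : ℕ} (hθ : 0 < θ) :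
    (Fintype.card (Equiv.Perm (Fin n)) : ℝ)⁻¹ *
      ∑ σ, ∑ i : Fin n, guessDistance w σ (θ * (i / θ)) i ≤ 4 * √(n * θ * Real.log q) := by
  set N : ℝ := (Fintype.card (Equiv.Perm (Fin n)) : ℝ) with hN
  have hNpos : 0 < N := Nat.cast_pos.2 Fintype.card_pos
  have hlog : 0 ≤ Real.log q := Real.log_natCast_nonneg q
  have hsq : ∑ i : Fin n, ∑ σ, guessDistance w σ (θ * (i / θ)) i ^ 2 ≤
      16 * (θ * (N * Real.log q)) := by
    calc _ ≤ ∑ i : Fin n, 16 * (entropyIncrement w (θ * (i / θ)) - entropyIncrement w i) :=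
          Finset.sum_le_sum fun i _ => sum_sq_guessDistance_le hw hw1 i (Nat.mul_div_le _ _)
      _ = 16 * (∑ i ∈ Finset.range n, entropyIncrement w (θ * (i / θ)) -
            ∑ i ∈ Finset.range n, entropyIncrement w i) := by
          rw [← Finset.mul_sum, Finset.sum_sub_distrib,
            Finset.sum_range fun i => entropyIncrement w (θ * (i / θ)),
            Finset.sum_range fun i => entropyIncrement w i]
      _ ≤ 16 * (θ * entropyIncrement w 0) := by
          have := sum_mul_div_le (n := n) hθ (entropyIncrement_nonneg hw)
            (fun b i hb hi => entropyIncrement_anti hw hw1 hb hi)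
          linarith
      _ ≤ _ := by
          gcongr
          exact entropyIncrement_zero_le hw hw1 hq hn
  have hcs : (∑ σ, ∑ i : Fin n, guessDistance w σ (θ * (i / θ)) i) ^ 2 ≤
      (N * n) * ∑ i : Fin n, ∑ σ, guessDistance w σ (θ * (i / θ)) i ^ 2 := by
    have := sq_sum_le_card_mul_sum_sq (s := (Finset.univ : Finset (Equiv.Perm (Fin n) × Fin n)))
      (f := fun p => guessDistance w p.1 (θ * (p.2 / θ)) p.2)
    rw [Fintype.sum_prod_type, Fintype.sum_prod_type, Finset.card_univ, Fintype.card_prod,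
      Fintype.card_fin, Finset.sum_comm (f := fun σ (i : Fin n) => guessDistance w σ (θ * (i / θ)) i ^ 2)]
      at this
    push_cast at this
    exact this
  rw [inv_mul_le_iff₀ hNpos]
  refine abs_le_of_sq_le_sq' (hcs.trans ?_) (by positivity) |>.2
  rw [mul_pow, mul_pow, Real.sq_sqrt (by positivity)]
  calc _ ≤ (N * n) * (16 * (θ * (N * Real.log q))) := by gcongr
    _ = _ := by ring

theorem guessDistance_self (w : (Fin n → Fin q) → ℝ) (σ : Equiv.Perm (Fin n)) (i : Fin n) :
    guessDistance w σ i i = 0 := by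
  simp [guessDistance]

end Average

/-- The sampler for an alphabet with one symbol. -/
noncomputable def trivialSampler (n q : ℕ) [NeZero q] : RandomizedSampler n q where
  Seed := Unit
  law := Measure.dirac ()
  strategy _ := .halt 0
  measurable_output _ := measurable_const
  measurable_rounds _ := measurable_const
  measurable_queries _ := measurable_const

theorem two_thirds_mul_log_le {n q : ℕ} (hn : 2 ≤ n) (hq : 2 ≤ q) :
    Real.log q ^ (1 / 3 : ℝ) ≤ 4 * min (Real.log n ^ (2 / 3 : ℝ) * Real.log q)
      ((q : ℝ) ^ (1 / 3 : ℝ) * Real.log q ^ (1 / 3 : ℝ)) := by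
  have hhalf : ∀ m : ℕ, 2 ≤ m → 1 / 2 ≤ Real.log m := fun m hm => by
    have h1 : Real.log 2 ≤ Real.log m := Real.log_le_log two_pos (by exact_mod_cast hm)
    linarith [Real.log_two_gt_d9]
  have hpow : ∀ a : ℝ, 1 / 2 ≤ a → 1 / 2 ≤ a ^ (2 / 3 : ℝ) := fun a ha => by
    calc (1 / 2 : ℝ) = (1 / 2) ^ (1 : ℝ) := (Real.rpow_one _).symm
      _ ≤ (1 / 2) ^ (2 / 3 : ℝ) :=
          Real.rpow_le_rpow_of_exponent_ge (by norm_num) (by norm_num) (by norm_num)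
      _ ≤ _ := Real.rpow_le_rpow (by norm_num) ha (by norm_num)
  have hL := hhalf q hq
  have hL0 : 0 < Real.log q := by linarith
  have hL3 : 0 < Real.log q ^ (1 / 3 : ℝ) := Real.rpow_pos_of_pos hL0 _
  rw [mul_min_of_nonneg _ _ (by norm_num)]
  refine le_min ?_ ?_
  · have h1 := hpow _ (hhalf n hn)
    have h2 := hpow _ hL
    have h3 : Real.log q = Real.log q ^ (2 / 3 : ℝ) * Real.log q ^ (1 / 3 : ℝ) := by
      rw [← Real.rpow_add hL0]
      norm_num
    have h4 : 1 / 2 * (1 / 2) ≤ Real.log n ^ (2 / 3 : ℝ) * Real.log q ^ (2 / 3 : ℝ) :=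
      mul_le_mul h1 h2 (by norm_num) (by linarith)
    calc Real.log q ^ (1 / 3 : ℝ) ≤ 4 * ((Real.log n ^ (2 / 3 : ℝ) * Real.log q ^ (2 / 3 : ℝ)) *
          Real.log q ^ (1 / 3 : ℝ)) := by nlinarith
      _ = _ := by rw [mul_assoc, ← h3]
  · have h1 : 1 ≤ (q : ℝ) ^ (1 / 3 : ℝ) :=
      Real.one_le_rpow (by exact_mod_cast (by omega : 1 ≤ q)) (by norm_num)
    nlinarith

theorem theorem1p1 :
    ∃ C : ℝ, ∀ n q : ℕ, 2 ≤ n → 1 ≤ q →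
      ∃ A : RandomizedSampler n q,
        ∀ (μ : Measure (Fin n → Fin q)) [IsProbabilityMeasure μ] (O : Oracle n q),
          IsConditionalMarginalOracle μ O →
            -- the output is an exact sample from `μ`
            A.law.map (fun s => (A.strategy s).output O) = μ ∧
            -- the total number of queries is `O(n)`, for every outcome of the random seed
            (∀ s : A.Seed, ((A.strategy s).queries O : ℝ) ≤ C * n) ∧
            -- the expected number of rounds
            ∫⁻ s, ((A.strategy s).rounds O : ENNReal) ∂A.law ≤
              ENNReal.ofReal (C * ((n : ℝ) ^ (2 / 3 : ℝ) *
                min (Real.log n ^ (2 / 3 : ℝ) * Real.log q)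
                  ((q : ℝ) ^ (1 / 3 : ℝ) * Real.log q ^ (1 / 3 : ℝ)))) := by
  refine ⟨64, fun n q hn hq => ?_⟩
  have : NeZero q := ⟨by omega⟩
  rcases hq.eq_or_lt with rfl | hq2
  · refine ⟨trivialSampler n 1, fun μ _ O _ => ⟨?_, fun s => ?_, ?_⟩⟩
    · refine Measure.ext_of_singleton fun x => ?_
      have hx : ({x} : Set (Fin n → Fin 1)) = Set.univ := Set.eq_univ_of_forall fun y =>
        Subsingleton.elim y x
      have := Measure.isProbabilityMeasure_map (μ := (trivialSampler n 1).law)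
        ((trivialSampler n 1).measurable_output O).aemeasurable
      rw [hx, measure_univ, measure_univ]
    · simp [trivialSampler, Strategy.queries]
    · simp only [trivialSampler, Strategy.rounds, Nat.cast_zero]
      exact lintegral_zero.trans_le zero_le
  have hn0 : (0 : ℝ) < n := by positivity
  have hn2 : (2 : ℝ) ≤ n := by exact_mod_cast hn
  set L := Real.log q with hLdef
  have hL : 1 / 2 ≤ L := by
    have h1 : Real.log 2 ≤ L := Real.log_le_log two_pos (by exact_mod_cast hq2)
    linarith [Real.log_two_gt_d9]
  have hL0 : 0 < L := by linarith
  set t : ℝ := (n / L) ^ (1 / 3 : ℝ) with ht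
  have ht0 : 0 < t := Real.rpow_pos_of_pos (div_pos hn0 hL0) _
  have ht3 : t ^ 3 = n / L := by
    rw [ht, ← Real.rpow_natCast, ← Real.rpow_mul (div_pos hn0 hL0).le]
    norm_num
  have htL : t ^ 3 * L = n := by rw [ht3, div_mul_cancel₀ _ hL0.ne']
  set R : ℝ := (n : ℝ) ^ (2 / 3 : ℝ) * L ^ (1 / 3 : ℝ) with hR
  have hR0 : 0 < R := mul_pos (Real.rpow_pos_of_pos hn0 _) (Real.rpow_pos_of_pos hL0 _)
  have hRt : R * t = n := by
    rw [hR, ht, Real.div_rpow hn0.le hL0.le, mul_assoc,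
      mul_div_cancel₀ _ (Real.rpow_pos_of_pos hL0 _).ne', ← Real.rpow_add hn0]
    norm_num
  have hR2 : n * t * L = R ^ 2 := by
    have : (n * t * L) * t ^ 2 = R ^ 2 * t ^ 2 := by
      calc _ = n * (t ^ 3 * L) := by ring
        _ = (R * t) * (R * t) := by rw [htL, hRt]
        _ = _ := by ring
    exact mul_right_cancel₀ (pow_pos ht0 2).ne' this
  have htn : t ≤ n := by
    by_contra! h
    have h1 : (n : ℝ) ^ 3 < t ^ 3 := pow_lt_pow_left₀ h hn0.le (by norm_num)
    have h2 : (n : ℝ) ^ 3 * L < n := (mul_lt_mul_of_pos_right h1 hL0).trans_eq htL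
    have h3 : 1 ≤ (n : ℝ) ^ 2 * L := by nlinarith
    have h4 : (n : ℝ) * 1 ≤ n * (n ^ 2 * L) := mul_le_mul_of_nonneg_left h3 hn0.le
    linarith
  have hR1 : 1 ≤ R := by
    by_contra! h
    nlinarith
  set θ := ⌈t⌉₊ with hθdef
  have hθ : 0 < θ := Nat.ceil_pos.2 ht0
  have hθn : θ ≤ n := Nat.ceil_le.2 htn
  have htθ : t ≤ θ := Nat.le_ceil t
  refine ⟨randomBlockSampler n q θ hθ, fun μ _ O hO =>
    ⟨map_output_randomBlockSampler hθ hO, fun s => ?_, ?_⟩⟩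
  · have h := (Strategy.blockSampler_spec hθ s.1 s.2 O).2.2
    have h' : 8 * θ * (n / θ + 1) ≤ 64 * n := by
      have := Nat.mul_div_le n θ
      nlinarith
    exact_mod_cast h.trans h'
  · refine (lintegral_rounds_randomBlockSampler_le hθ hO).trans (ENNReal.ofReal_le_ofReal ?_)
    have hw : ∀ z : Fin n → Fin q, 0 ≤ μ.real {z} := fun z => measureReal_nonneg
    have hw1 : ∑ z : Fin n → Fin q, μ.real {z} = 1 := by
      rw [sum_measureReal_singleton]
      simp
    have hblocks : ((n / θ : ℕ) : ℝ) ≤ R := by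
      refine Nat.cast_div_le.trans ?_
      rw [div_le_iff₀ (by exact_mod_cast hθ), ← hRt]
      gcongr
    have herr : (Fintype.card (Equiv.Perm (Fin n)) : ℝ)⁻¹ * ∑ σ, ∑ i : Fin n,
        guessDistance (fun z => μ.real {z}) σ (θ * (i / θ)) i ≤ 6 * R := by
      rcases le_total t 1 with h1 | h1
      · have hone : θ = 1 := le_antisymm (Nat.ceil_le.2 (by simpa using h1)) hθ
        simp only [hone, Nat.div_one, one_mul, guessDistance_self, Finset.sum_const_zero, mul_zero]
        positivity
      · refine (average_guessDistance_le hw hw1 (by omega) (by omega) hθ).trans ?_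
        have hθ2 : (θ : ℝ) ≤ 2 * t := by
          have := Nat.ceil_lt_add_one ht0.le
          linarith
        have : √(n * θ * L) ≤ 3 / 2 * R := by
          rw [Real.sqrt_le_left (by positivity)]
          calc n * θ * L ≤ n * (2 * t) * L := by gcongr
            _ = 2 * R ^ 2 := by rw [← hR2]; ring
            _ ≤ _ := by nlinarith [sq_nonneg R]
        linarith
    have hmin := mul_le_mul_of_nonneg_left (two_thirds_mul_log_le hn hq2)
      (Real.rpow_pos_of_pos hn0 (2 / 3)).le
    rw [← hLdef, ← hR] at hmin
    calc _ ≤ 16 * R := by linarith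
      _ ≤ _ := by linarith
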